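/- Let $\mathbf k=\mathbb F_q$ be a finite field. Let $\mathcal H$ be the following $\mathbb Q$-linear category with a monoidal product. Objects: finite-dimensional $\mathbb Z$-graded $\mathbf k$-vector spaces $V$ with a complete flag of graded subspaces $0=F_0V\subset F_1V\subset\dots\subset F_{\dim V}V=V$, $\dim F_iV=i$. We write $\mathrm{Hom}^n(V,W)$ for the homogeneous linear maps of degree $n$ and $\mathrm{Hom}^n_{<0}(V,V)$ for those $a\in\mathrm{Hom}^n(V,V)$ with $a(F_iV)\subseteq F_{i-1}V$. The monoidal product $V\otimes W$ is $V\oplus W$ with the flag $F_0V\subset\dots\subset F_{\dim V}V\subset V\oplus F_1W\subset\dots\subset V\oplus W$. Morphisms: $\mathrm{Hom}_{\mathcal H}(V,W)$ is the $\mathbb Q$-vector space with basis the equivalence classes of triples $(d_V,f,d_W)$, where $d_V\in\mathrm{Hom}^1_{<0}(V,V)$ and $d_W\in\mathrm{Hom}^1_{<0}(W,W)$ are differentials (square zero) and $f:(V,d_V)\to(W,d_W)$ is a quasi-isomorphism; $(d_V,f,d_W)\sim(d_V',f',d_W')$ if there are isomorphisms of complexes $\phi:(V,d_V)\to(V,d_V')$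 and $\psi:(W,d_W)\to(W,d_W')$ preserving grading and flag with $\psi f$ homotopic to $f'\phi$. Composition is the bilinear extension of $$(d_V',g,d_W)\circ(d_U,f,d_V)=\Big(\prod_{i\ge1}|\mathrm{Hom}^{-i}_{<0}(V,V)|^{(-1)^i}\Big)\sum_b(d_U,gbf,d_W),$$ the sum being over all isomorphisms $b:(V,d_V)\to(V,d_V')$ of complexes preserving grading and flag. The monoidal product of morphisms is the bilinear extension of $$(d_U,f,d_V)\otimes(d_X,g,d_Y)=\prod_{i\ge0}\big(|\mathrm{Hom}^{-i}(X,U)||\mathrm{Hom}^{-i}(Y,V)||\mathrm{Hom}^{-i-1}(X,V)|\big)^{(-1)^{i+1}}\sum_\delta\left(\begin{bmatrix}d_U&\delta_{11}\\0&d_X\end{bmatrix},\begin{bmatrix}f&\delta_{12}\\0&g\end{bmatrix},\begin{bmatrix}d_V&\delta_{22}\\0&d_Y\end{bmatrix}\right),$$ the sum being over $\delta\in\mathrm{Hom}^1(X,U)\oplus\mathrm{Hom}^0(X,V)\oplus\mathrm{Hom}^1(Y,V)$ with $d_U\delta_{11}+\delta_{11}d_X=0$, $d_V\delta_{22}+\delta_{22}d_Y=0$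 and $\delta_{12}d_X+f\delta_{11}=d_V\delta_{12}+\delta_{22}g$. Proposition. For every triple $(d_V,f,d_W)$ the map $f$ has a homotopy inverse $f':(W,d_W)\to(V,d_V)$ (of degree $0$), and there are unique $\mathbb Q$-linear maps $D:\mathrm{Hom}_{\mathcal H}(V,W)\to\mathrm{Hom}_{\mathcal H}(W,V)$, for all objects $V,W$, such that $D(d_V,f,d_W)=(d_W,f',d_V)$ whenever $f'$ is a homotopy inverse of $f$, and which have the following properties: 1. $D(1_V)=1_V$ and $D(g\circ f)=D(f)\circ D(g)$, so that $D$, with the identity on objects, is a contravariant functor from $\mathcal H$ to itself; the functor $D:\mathcal H^{\mathrm{op}}\to\mathcal H$ is an equivalence of categories. 2. $D$ is covariant with respect to the monoidal product: $D(\alpha\otimes\beta)=D(\alpha)\otimes D(\beta)$ for all morphisms $\alpha:U\to V$ and $\beta:X\to Y$ of $\mathcal H$. -/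

import Mathlib

open CategoryTheory

universe v u

noncomputable section

namespace HallFlag

/-! ### Graded vector spaces with complete flag -/

/-- A finite-dimensional `ℤ`-graded vector space over `k` with a complete flag of graded subspaces
`0 = F₀ ⊂ F₁ ⊂ ⋯ ⊂ F_n = V`, `dim Fᵢ = i`. The flag is indexed by all natural numbers, with
`Fᵢ = V` for `i ≥ n`; this is what `finrank_flag` expresses. -/
structure FlagSpace (k : Type u) [Field k] : Type (max u (v + 1)) where
  carrier : Type v
  [addCommGroup : AddCommGroup carrier]
  [module : Module k carrier]
  [finite : FiniteDimensional k carrier]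
  grading : ℤ → Submodule k carrier
  isInternal : DirectSum.IsInternal grading
  flag : ℕ → Submodule k carrier
  flag_mono : Monotone flag
  finrank_flag : ∀ i, Module.finrank k (flag i) = min i (Module.finrank k carrier)
  flag_graded : ∀ i, flag i = ⨆ j, flag i ⊓ grading j

instance {k : Type u} [Field k] : CoeSort (FlagSpace.{v} k) (Type v) := ⟨FlagSpace.carrier⟩

attribute [instance] FlagSpace.addCommGroup FlagSpace.module FlagSpace.finite

variable {k : Type u} [Field k]

theorem FlagSpace.flag_zero (V : FlagSpace.{v} k) : V.flag 0 = ⊥ := by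
  apply Submodule.finrank_eq_zero.mp
  rw [V.finrank_flag]; simp

theorem FlagSpace.flag_top (V : FlagSpace.{v} k) {i : ℕ} (hi : Module.finrank k V ≤ i) :
    V.flag i = ⊤ := by
  apply Submodule.eq_top_of_finrank_eq
  rw [V.finrank_flag]; simpa using hi

/-- `Homⁿ(V, W)`: linear maps that are homogeneous of degree `n`. -/
def gradedHom (V W : FlagSpace.{v} k) (n : ℤ) : Submodule k (V →ₗ[k] W) where
  carrier := {f | ∀ i, ∀ x ∈ V.grading i, f x ∈ W.grading (i + n)}
  add_mem' hf hg _ _ hx := add_mem (hf _ _ hx) (hg _ _ hx)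
  zero_mem' _ _ _ := zero_mem _
  smul_mem' c _ hf _ _ hx := Submodule.smul_mem _ c (hf _ _ hx)

/-- `Homⁿ_{<0}(V, V)`: homogeneous endomorphisms of degree `n` which send `F_{i+1}` to `F_i`
(and `F₀ = 0` to `0`). -/
def strictHom (V : FlagSpace.{v} k) (n : ℤ) : Submodule k (V →ₗ[k] V) where
  carrier := {f | f ∈ gradedHom V V n ∧ ∀ i, ∀ x ∈ V.flag (i + 1), f x ∈ V.flag i}
  add_mem' hf hg := ⟨add_mem hf.1 hg.1, fun i x hx => add_mem (hf.2 i x hx) (hg.2 i x hx)⟩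
  zero_mem' := ⟨zero_mem _, fun _ _ _ => zero_mem _⟩
  smul_mem' c _ hf := ⟨Submodule.smul_mem _ c hf.1,
    fun i x hx => Submodule.smul_mem _ c (hf.2 i x hx)⟩

/-- The group of linear automorphisms of `V` preserving the grading and the flag. -/
def autGroup (V : FlagSpace.{v} k) : Subgroup (V ≃ₗ[k] V) where
  carrier := {φ | (∀ i x, φ x ∈ V.grading i ↔ x ∈ V.grading i) ∧
    ∀ i x, φ x ∈ V.flag i ↔ x ∈ V.flag i}
  mul_mem' ha hb := ⟨fun i x => (ha.1 i _).trans (hb.1 i x), fun i x => (ha.2 i _).trans (hb.2 i x)⟩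
  one_mem' := ⟨fun _ _ => Iff.rfl, fun _ _ => Iff.rfl⟩
  inv_mem' {φ} h := by
    refine ⟨fun i x => ?_, fun i x => ?_⟩
    · rw [← h.1 i (φ⁻¹ x)]; exact iff_of_eq (congrArg (· ∈ V.grading i) (φ.apply_symm_apply x))
    · rw [← h.2 i (φ⁻¹ x)]; exact iff_of_eq (congrArg (· ∈ V.flag i) (φ.apply_symm_apply x))

theorem autGroup_degree {V : FlagSpace.{v} k} {φ : V ≃ₗ[k] V} (h : φ ∈ autGroup V) {i : ℤ} {x : V}
    (hx : x ∈ V.grading i) : φ x ∈ V.grading i := (h.1 i x).2 hx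

theorem autGroup_symm {V : FlagSpace.{v} k} {φ : V ≃ₗ[k] V} (h : φ ∈ autGroup V) :
    φ.symm ∈ autGroup V := inv_mem h

theorem autGroup_trans {V : FlagSpace.{v} k} {φ ψ : V ≃ₗ[k] V} (h : φ ∈ autGroup V)
    (h' : ψ ∈ autGroup V) : φ.trans ψ ∈ autGroup V := mul_mem h' h

/-! ### Differentials, cohomology, quasi-isomorphisms -/

/-- A flag-decreasing differential (of degree `1`) on `V`. -/
@[ext]
structure Differential (V : FlagSpace.{v} k) where
  toHom : V →ₗ[k] V
  mem : toHom ∈ strictHom V 1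
  sq : ∀ x, toHom (toHom x) = 0

instance (V : FlagSpace.{v} k) : CoeFun (Differential V) (fun _ => V → V) := ⟨fun d => d.toHom⟩

/-- The (total) cohomology `ker d / im d`. -/
abbrev Cohomology {V : FlagSpace.{v} k} (d : Differential V) : Type v :=
  LinearMap.ker d.toHom ⧸ (LinearMap.range d.toHom).submoduleOf (LinearMap.ker d.toHom)

/-- The map induced on cohomology by a map commuting with the differentials. -/
def cohomologyMap {V W : FlagSpace.{v} k} (d : Differential V) (d' : Differential W)
    (f : V →ₗ[k] W) (hf : ∀ x, f (d x) = d' (f x)) : Cohomology d →ₗ[k] Cohomology d' :=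
  Submodule.mapQ _ _
    (f.restrict (p := LinearMap.ker d.toHom) (q := LinearMap.ker d'.toHom) (fun x hx => by
      rw [LinearMap.mem_ker] at hx ⊢; rw [← hf, hx, map_zero]))
    (by
      rintro ⟨x, hx⟩ ⟨y, hy⟩
      exact ⟨f y, by rw [← hf]; exact congrArg f hy⟩)

/-- `f : (V, d) → (W, d')` is a quasi-isomorphism: a map of graded vector spaces commuting with the
differentials and inducing an isomorphism on cohomology. -/
def IsQuasiIso {V W : FlagSpace.{v} k} (d : Differential V) (d' : Differential W)
    (f : V →ₗ[k] W) : Prop :=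
  f ∈ gradedHom V W 0 ∧
    ∃ hf : ∀ x, f (d x) = d' (f x), Function.Bijective (cohomologyMap d d' f hf)

theorem isQuasiIso_iff {V W : FlagSpace.{v} k} (d : Differential V) (d' : Differential W)
    (f : V →ₗ[k] W) : IsQuasiIso d d' f ↔ f ∈ gradedHom V W 0 ∧ (∀ x, f (d x) = d' (f x)) ∧
      (∀ x, d x = 0 → (∃ y, d' y = f x) → ∃ z, d z = x) ∧
      (∀ y, d' y = 0 → ∃ x, d x = 0 ∧ ∃ z, f x + d' z = y) := by
  unfold IsQuasiIso
  refine and_congr_right fun _ => ⟨?_, ?_⟩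
  · rintro ⟨hf, hi, hs⟩
    refine ⟨hf, ?_, ?_⟩
    · rintro x hx ⟨y, hy⟩
      have h0 : cohomologyMap d d' f hf (Submodule.Quotient.mk ⟨x, hx⟩) = 0 := by
        refine (Submodule.Quotient.mk_eq_zero _).2 ?_
        exact ⟨y, hy⟩
      have h1 := (injective_iff_map_eq_zero _).1 hi _ h0
      obtain ⟨z, hz⟩ := (Submodule.Quotient.mk_eq_zero _).1 h1
      exact ⟨z, hz⟩
    · intro y hy
      obtain ⟨c, hc⟩ := hs (Submodule.Quotient.mk ⟨y, hy⟩)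
      obtain ⟨⟨x, hx⟩, rfl⟩ := Submodule.Quotient.mk_surjective _ c
      obtain ⟨z, hz⟩ := (Submodule.Quotient.eq _).1 hc.symm
      refine ⟨x, hx, z, ?_⟩
      have hz' : d' z = y - f x := hz
      rw [hz']; abel
  · rintro ⟨hf, hi, hs⟩
    refine ⟨hf, (injective_iff_map_eq_zero _).2 ?_, ?_⟩
    · intro c hc
      obtain ⟨⟨x, hx⟩, rfl⟩ := Submodule.Quotient.mk_surjective _ c
      obtain ⟨y, hy⟩ := (Submodule.Quotient.mk_eq_zero _).1 hc
      obtain ⟨z, hz⟩ := hi x hx ⟨y, hy⟩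
      exact (Submodule.Quotient.mk_eq_zero _).2 ⟨z, hz⟩
    · intro c
      obtain ⟨⟨y, hy⟩, rfl⟩ := Submodule.Quotient.mk_surjective _ c
      obtain ⟨x, hx, z, hz⟩ := hs y hy
      refine ⟨Submodule.Quotient.mk ⟨x, hx⟩, ?_⟩
      refine ((Submodule.Quotient.eq _).2 ?_).symm
      exact ⟨z, show d' z = y - f x by rw [← hz]; abel⟩

/-! ### The basis of the Hom-spaces -/

/-- A triple `(d_V, f, d_W)`: flag-decreasing differentials on `V` and `W` and a quasi-isomorphism
`f : (V, d_V) → (W, d_W)`. -/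
structure Triple (V W : FlagSpace.{v} k) where
  dSource : Differential V
  map : V →ₗ[k] W
  dTarget : Differential W
  quasiIso : IsQuasiIso dSource dTarget map

/-- `f` and `g` are homotopic as maps `(V, d) → (W, d')`. -/
def Homotopic {V W : FlagSpace.{v} k} (d : Differential V) (d' : Differential W)
    (f g : V →ₗ[k] W) : Prop :=
  ∃ h ∈ gradedHom V W (-1), ∀ x, f x - g x = d' (h x) + h (d x)

/-- Automorphisms `b` of `V`, preserving grading and flag, with `b ∘ d = d' ∘ b`: isomorphisms
`(V, d) → (V, d')` of chain complexes with complete flag. -/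
def ChainIso {V : FlagSpace.{v} k} (d d' : Differential V) : Type v :=
  {b : V ≃ₗ[k] V // b ∈ autGroup V ∧ ∀ x, b (d x) = d' (b x)}

/-- Equivalence of triples. -/
def Triple.Equivalent {V W : FlagSpace.{v} k} (t t' : Triple V W) : Prop :=
  ∃ (φ : ChainIso t.dSource t'.dSource) (ψ : ChainIso t.dTarget t'.dTarget),
    Homotopic t.dSource t'.dTarget (ψ.1.toLinearMap ∘ₗ t.map) (t'.map ∘ₗ φ.1.toLinearMap)

def ChainIso.refl {V : FlagSpace.{v} k} (d : Differential V) : ChainIso d d :=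
  ⟨LinearEquiv.refl k V, one_mem (autGroup V), fun _ => rfl⟩

def ChainIso.symm {V : FlagSpace.{v} k} {d d' : Differential V} (b : ChainIso d d') :
    ChainIso d' d :=
  ⟨b.1.symm, autGroup_symm b.2.1, fun x => b.1.injective (by
    rw [b.2.2, LinearEquiv.apply_symm_apply, LinearEquiv.apply_symm_apply])⟩

def ChainIso.trans {V : FlagSpace.{v} k} {d d' d'' : Differential V} (b : ChainIso d d')
    (c : ChainIso d' d'') : ChainIso d d'' :=
  ⟨b.1.trans c.1, autGroup_trans b.2.1 c.2.1, fun x => by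
    simp only [LinearEquiv.trans_apply]; rw [b.2.2, c.2.2]⟩

theorem gradedHom_apply {V W : FlagSpace.{v} k} {n : ℤ} {f : V →ₗ[k] W} (hf : f ∈ gradedHom V W n)
    {i j : ℤ} (hj : i + n = j) {x : V} (hx : x ∈ V.grading i) : f x ∈ W.grading j :=
  hj ▸ hf i x hx

theorem gradedHom_comp {U V W : FlagSpace.{v} k} {m n p : ℤ} {f : U →ₗ[k] V} {g : V →ₗ[k] W}
    (hf : f ∈ gradedHom U V m) (hg : g ∈ gradedHom V W n) (hp : m + n = p) :
    g ∘ₗ f ∈ gradedHom U W p := fun _ _ hx =>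
  gradedHom_apply hg (by rw [add_assoc, hp]) (hf _ _ hx)

theorem ChainIso.degree {V : FlagSpace.{v} k} {d d' : Differential V} (b : ChainIso d d') :
    b.1.toLinearMap ∈ gradedHom V V 0 := fun i x hx => by
  rw [add_zero]; exact autGroup_degree b.2.1 hx

theorem Triple.degree {V W : FlagSpace.{v} k} (t : Triple V W) : t.map ∈ gradedHom V W 0 :=
  t.quasiIso.1

theorem Triple.comm {V W : FlagSpace.{v} k} (t : Triple V W) (x : V) :
    t.map (t.dSource x) = t.dTarget (t.map x) := t.quasiIso.2.1 x

instance tripleSetoid (V W : FlagSpace.{v} k) : Setoid (Triple V W) where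
  r := Triple.Equivalent
  iseqv :=
    { refl := fun t => ⟨ChainIso.refl _, ChainIso.refl _, 0, zero_mem _, fun x => by
        simp [ChainIso.refl]⟩
      symm := by
        rintro t t' ⟨φ, ψ, h, hh, H⟩
        refine ⟨φ.symm, ψ.symm, -(ψ.symm.1.toLinearMap ∘ₗ h ∘ₗ φ.symm.1.toLinearMap),
          neg_mem (gradedHom_comp (gradedHom_comp φ.symm.degree hh rfl) ψ.symm.degree
            (by norm_num)), fun x => ?_⟩
        have h1 := H (φ.symm.1 x)
        have h2 : φ.1 (φ.symm.1 x) = x := φ.1.apply_symm_apply x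
        have h4 : ∀ y, ψ.symm.1 (ψ.1 y) = y := ψ.1.symm_apply_apply
        simp only [LinearMap.comp_apply, LinearEquiv.coe_coe, LinearMap.neg_apply, map_neg] at h1 ⊢
        rw [h2, ← φ.symm.2.2] at h1
        have h3 := congrArg ψ.symm.1 h1
        rw [map_sub, map_add, h4, ψ.symm.2.2] at h3
        rw [← neg_sub, h3]; abel
      trans := by
        rintro t t' t'' ⟨φ, ψ, h, hh, H⟩ ⟨φ', ψ', h', hh', H'⟩
        refine ⟨φ.trans φ', ψ.trans ψ', ψ'.1.toLinearMap ∘ₗ h + h' ∘ₗ φ.1.toLinearMap,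
          add_mem (gradedHom_comp hh ψ'.degree (by norm_num))
            (gradedHom_comp φ.degree hh' (by norm_num)), fun x => ?_⟩
        have h1 := H x
        have h2 := H' (φ.1 x)
        have h3 := congrArg ψ'.1 h1
        simp only [LinearMap.comp_apply, LinearEquiv.coe_coe, LinearMap.add_apply, map_add, map_sub,
          ChainIso.trans, LinearEquiv.trans_apply] at h1 h2 h3 ⊢
        rw [ψ'.2.2] at h3
        rw [φ.2.2, ← sub_add_sub_cancel _ (ψ'.1 (t'.map (φ.1 x))) _, h3, h2]; abel }

/-- The set `B(V, W)` of equivalence classes of triples. -/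
abbrev TripleClass (V W : FlagSpace.{v} k) : Type v := Quotient (tripleSetoid V W)

/-- The rational vector space with basis `B(V, W)`. -/
abbrev HomSpace (V W : FlagSpace.{v} k) : Type v := TripleClass V W →₀ ℚ

/-- The basis element of the Hom-space represented by a triple. -/
def Triple.basis {V W : FlagSpace.{v} k} (t : Triple V W) : HomSpace V W :=
  Finsupp.single (Quotient.mk _ t) 1

theorem Triple.basis_eq {V W : FlagSpace.{v} k} {t t' : Triple V W} (h : t.Equivalent t') :
    t.basis = t'.basis := by
  unfold Triple.basis; rw [Quotient.sound (s := tripleSetoid V W) h]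

/-- Bilinear extension of a map defined on pairs of basis elements. -/
def bilinearExtend {α β M : Type*} [AddCommGroup M] [Module ℚ M] (B : α → β → M) :
    (α →₀ ℚ) →ₗ[ℚ] (β →₀ ℚ) →ₗ[ℚ] M :=
  Finsupp.linearCombination ℚ fun a => Finsupp.linearCombination ℚ (B a)

theorem bilinearExtend_single {α β M : Type*} [AddCommGroup M] [Module ℚ M] (B : α → β → M)
    (a : α) (b : β) : bilinearExtend B (Finsupp.single a 1) (Finsupp.single b 1) = B a b := by
  simp [bilinearExtend]

instance [Finite k] (V W : FlagSpace.{v} k) : Finite (V →ₗ[k] W) :=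
  haveI := Module.finite_of_finite k (M := V)
  haveI := Module.finite_of_finite k (M := W)
  DFunLike.finite _

instance [Finite k] (V : FlagSpace.{v} k) : Finite (V ≃ₗ[k] V) :=
  Finite.of_injective (fun e : V ≃ₗ[k] V => e.toLinearMap) LinearEquiv.toLinearMap_injective

instance [Finite k] (V : FlagSpace.{v} k) : Fintype (Differential V) :=
  haveI : Finite (Differential V) :=
    Finite.of_injective Differential.toHom fun _ _ h => Differential.ext h
  Fintype.ofFinite _

instance [Finite k] {V : FlagSpace.{v} k} (d d' : Differential V) : Fintype (ChainIso d d') :=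
  haveI : Finite (ChainIso d d') := Subtype.finite
  Fintype.ofFinite _

/-! ### Composition -/

/-- The factor `∏_{i ≥ 1} |Hom^{-i}_{<0}(V, V)|^{(-1)^i}`. -/
def compFactor (V : FlagSpace.{v} k) : ℚ :=
  ∏ᶠ i : ℕ, (Nat.card (strictHom V (-(i + 1 : ℕ))) : ℚ) ^ ((-1 : ℤ) ^ (i + 1))

theorem ChainIso.isQuasiIso {V : FlagSpace.{v} k} {d d' : Differential V} (b : ChainIso d d') :
    IsQuasiIso d d' b.1.toLinearMap := by
  rw [isQuasiIso_iff]
  refine ⟨b.degree, b.2.2, ?_, ?_⟩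
  · rintro x - ⟨y, hy⟩
    refine ⟨b.symm.1 y, ?_⟩
    rw [← b.symm.2.2, hy]; exact b.1.symm_apply_apply x
  · intro y hy
    refine ⟨b.symm.1 y, by rw [← b.symm.2.2, hy, map_zero], 0, ?_⟩
    rw [map_zero, add_zero]; exact b.1.apply_symm_apply y

theorem IsQuasiIso.comp {U V W : FlagSpace.{v} k} {d : Differential U} {d' : Differential V}
    {d'' : Differential W} {g : V →ₗ[k] W} {f : U →ₗ[k] V} (hg : IsQuasiIso d' d'' g)
    (hf : IsQuasiIso d d' f) : IsQuasiIso d d'' (g ∘ₗ f) := by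
  rw [isQuasiIso_iff] at *
  obtain ⟨f0, f1, f2, f3⟩ := hf
  obtain ⟨g0, g1, g2, g3⟩ := hg
  refine ⟨gradedHom_comp f0 g0 rfl, fun x => ?_, ?_, ?_⟩
  · simp only [LinearMap.comp_apply]; rw [f1, g1]
  · intro x hx hy
    exact f2 x hx (g2 (f x) (by rw [← f1, hx, map_zero]) hy)
  · intro y hy
    obtain ⟨x, hx, z, hz⟩ := g3 y hy
    obtain ⟨w, hw, z', hz'⟩ := f3 x hx
    refine ⟨w, hw, z + g z', ?_⟩
    rw [← hz, ← hz', map_add, map_add, ← g1]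
    simp only [LinearMap.comp_apply]; abel

/-- The triple `(d_U, g b f, d_W)`. -/
def Triple.glue {U V W : FlagSpace.{v} k} (t : Triple U V) (s : Triple V W)
    (b : ChainIso t.dTarget s.dSource) : Triple U W where
  dSource := t.dSource
  map := s.map ∘ₗ b.1.toLinearMap ∘ₗ t.map
  dTarget := s.dTarget
  quasiIso := s.quasiIso.comp (b.isQuasiIso.comp t.quasiIso)

/-- The composition of the basis elements represented by `t = (d_U, f, d_V)` and
`s = (d_V', g, d_W)`; `t` is applied first. -/
def Triple.comp [Finite k] {U V W : FlagSpace.{v} k} (t : Triple U V) (s : Triple V W) :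
    HomSpace U W :=
  compFactor V • ∑ b : ChainIso t.dTarget s.dSource, (t.glue s b).basis

def ChainIso.conj {V : FlagSpace.{v} k} {d₁ d₁' d₂ d₂' : Differential V} (ψ : ChainIso d₁ d₁')
    (φ : ChainIso d₂ d₂') : ChainIso d₁ d₂ ≃ ChainIso d₁' d₂' where
  toFun b := (ψ.symm.trans b).trans φ
  invFun b := (ψ.trans b).trans φ.symm
  left_inv b := Subtype.ext (LinearEquiv.ext fun x => by
    simp [ChainIso.trans, ChainIso.symm])
  right_inv b := Subtype.ext (LinearEquiv.ext fun x => by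
    simp [ChainIso.trans, ChainIso.symm])

theorem Triple.comp_congr [Finite k] {U V W : FlagSpace.{v} k} {t t' : Triple U V}
    {s s' : Triple V W} (ht : t.Equivalent t') (hs : s.Equivalent s') :
    t.comp s = t'.comp s' := by
  obtain ⟨φ, ψ, h, hh, H⟩ := ht
  obtain ⟨φ', ψ', h', hh', H'⟩ := hs
  unfold Triple.comp
  congr 1
  refine Fintype.sum_equiv (ψ.conj φ') _ _ fun b => Triple.basis_eq ?_
  have hb := (ψ.conj φ' b).degree
  refine ⟨φ, ψ', h' ∘ₗ b.1.toLinearMap ∘ₗ t.map +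
      s'.map ∘ₗ (ψ.conj φ' b).1.toLinearMap ∘ₗ h,
    add_mem (gradedHom_comp (gradedHom_comp t.degree b.degree rfl) hh' (by norm_num))
      (gradedHom_comp (gradedHom_comp hh hb rfl) s'.degree (by norm_num)), fun x => ?_⟩
  have h1 := H x
  have h2 := H' (b.1 (t.map x))
  have h3 : ∀ y, (ψ.conj φ' b).1 (ψ.1 y) = φ'.1 (b.1 y) := fun y => by
    change φ'.1 (b.1 (ψ.1.symm (ψ.1 y))) = _
    rw [LinearEquiv.symm_apply_apply]
  have h4 := congrArg (fun y => s'.map ((ψ.conj φ' b).1 y)) h1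
  have h5 := (ψ.conj φ' b).2.2
  simp only [LinearMap.comp_apply, LinearEquiv.coe_coe, LinearMap.add_apply, map_add, map_sub,
    Triple.glue] at h1 h2 h4 ⊢
  rw [h3, h5, s'.comm] at h4
  rw [t.comm, b.2.2, ← sub_add_sub_cancel _ (s'.map (φ'.1 (b.1 (t.map x)))) _, h2, h4]
  abel

/-- Composition of morphisms, in diagrammatic order. -/
def homComp [Finite k] (U V W : FlagSpace.{v} k) :
    HomSpace U V →ₗ[ℚ] HomSpace V W →ₗ[ℚ] HomSpace U W :=
  bilinearExtend fun a b => Quotient.liftOn₂ a b Triple.comp fun _ _ _ _ => Triple.comp_congr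

theorem homComp_basis [Finite k] {U V W : FlagSpace.{v} k} (t : Triple U V) (s : Triple V W) :
    homComp U V W t.basis s.basis = t.comp s := bilinearExtend_single _ _ _

/-- The triple `(d, 1, d)`. -/
def Triple.one {V : FlagSpace.{v} k} (d : Differential V) : Triple V V where
  dSource := d
  map := LinearMap.id
  dTarget := d
  quasiIso := (ChainIso.refl d).isQuasiIso

/-- The identity of `V`: a multiple of `∑_d (d, 1, d)`, the sum being over all flag-decreasing
differentials. The normalization is expressed through the number of flag-preserving automorphisms
`|Aut V| = (q - 1)^{dim V} |Hom⁰_{<0}(V, V)|`. -/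
def homId [Finite k] (V : FlagSpace.{v} k) : HomSpace V V :=
  ((Nat.card (autGroup V) : ℚ)⁻¹ * (compFactor V)⁻¹) • ∑ d : Differential V, (Triple.one d).basis

theorem compFactor_ne_zero [Finite k] (V : FlagSpace.{v} k) : compFactor V ≠ 0 :=
  finprod_induction (· ≠ (0 : ℚ)) one_ne_zero (fun _ _ => mul_ne_zero) fun _ =>
    zpow_ne_zero _ (Nat.cast_ne_zero.2 Nat.card_pos.ne')

theorem HomSpace.induction {V W : FlagSpace.{v} k} {p : HomSpace V W → Prop} (h0 : p 0)
    (hadd : ∀ f g, p f → p g → p (f + g)) (hsmul : ∀ (c : ℚ) (t : Triple V W), p (c • t.basis))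
    (f : HomSpace V W) : p f := by
  refine Finsupp.induction_linear f h0 hadd fun a c => ?_
  obtain ⟨t, rfl⟩ := Quotient.exists_rep a
  have := hsmul c t
  rwa [Triple.basis, Finsupp.smul_single, smul_eq_mul, mul_one] at this

theorem homComp_assoc [Finite k] {U V W X : FlagSpace.{v} k} (f : HomSpace U V)
    (g : HomSpace V W) (h : HomSpace W X) :
    homComp U W X (homComp U V W f g) h = homComp U V X f (homComp V W X g h) := by
  induction f using HomSpace.induction with
  | h0 => simp
  | hadd a b ha hb => simp [ha, hb]
  | hsmul c t => ?_
  induction g using HomSpace.induction with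
  | h0 => simp
  | hadd a b ha hb => simpa using congrArg₂ (· + ·) ha hb
  | hsmul c' s => ?_
  induction h using HomSpace.induction with
  | h0 => simp
  | hadd a b ha hb =>
    rw [map_add, ha, hb, map_add, map_add]
  | hsmul c'' r => ?_
  simp only [map_smul, LinearMap.smul_apply, homComp_basis]
  congr 3
  simp only [Triple.comp, map_smul, LinearMap.smul_apply, map_sum, LinearMap.sum_apply,
    homComp_basis, Finset.smul_sum]
  refine Eq.trans (Finset.sum_comm (α := ChainIso s.dTarget r.dSource)
    (β := HomSpace U X) (γ := ChainIso t.dTarget s.dSource)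
    (s := Finset.univ) (t := Finset.univ)) ?_
  refine Finset.sum_congr rfl fun c _ => Finset.sum_congr rfl fun b _ => ?_
  rw [smul_comm]; rfl

theorem homId_comp [Finite k] {V W : FlagSpace.{v} k} (f : HomSpace V W) :
    homComp V V W (homId V) f = f := by
  induction f using HomSpace.induction with
  | h0 => simp
  | hadd a b ha hb => simp [ha, hb]
  | hsmul c t => ?_
  rw [map_smul]; congr 1
  have e : (Σ d : Differential V, ChainIso d t.dSource) ≃ autGroup V :=
    { toFun := fun p => ⟨p.2.1, p.2.2.1⟩
      invFun := fun b => ⟨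
        { toHom := b.1.symm.toLinearMap ∘ₗ t.dSource.toHom ∘ₗ b.1.toLinearMap
          mem := ⟨fun i x hx => autGroup_degree (autGroup_symm b.2)
              (t.dSource.mem.1 i _ (autGroup_degree b.2 hx)), fun i x hx =>
              ((autGroup_symm b.2).2 i _).2 (t.dSource.mem.2 i _ ((b.2.2 (i + 1) x).2 hx))⟩
          sq := fun x => by simp [t.dSource.sq] }, b.1, b.2, fun x => by simp⟩
      left_inv := by
        rintro ⟨d, b, hb, h⟩
        have hd : b.symm.toLinearMap ∘ₗ t.dSource.toHom ∘ₗ b.toLinearMap = d.toHom :=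
          LinearMap.ext fun x => b.injective (by simp [h])
        obtain ⟨d, hd1, hd2⟩ := d
        subst hd
        rfl
      right_inv := fun _ => rfl }
  have hb : ∀ (d : Differential V) (b : ChainIso (Triple.one d).dTarget t.dSource),
      ((Triple.one d).glue t b).basis = t.basis := fun d b =>
    Triple.basis_eq ⟨b, ChainIso.refl _, 0, zero_mem _, fun x => by
      simp [Triple.glue, Triple.one, ChainIso.refl]⟩
  have hc : (∑ d : Differential V, (Fintype.card (ChainIso d t.dSource) : ℚ)) =
      Nat.card (autGroup V) := by
    rw [← Nat.card_congr e, Nat.card_eq_fintype_card, Fintype.card_sigma, Nat.cast_sum]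
  have hA : (Nat.card (autGroup V) : ℚ) ≠ 0 := Nat.cast_ne_zero.2 Nat.card_pos.ne'
  have hsum : ∀ d : Differential V, (Triple.one d).comp t =
      (compFactor V * (Fintype.card (ChainIso d t.dSource) : ℚ)) • t.basis := fun d => by
    unfold Triple.comp
    rw [mul_smul, Finset.sum_congr rfl fun b _ => hb d b, Finset.sum_const, Finset.card_univ,
      Nat.cast_smul_eq_nsmul]
    rfl
  simp only [homId, map_smul, LinearMap.smul_apply, map_sum, LinearMap.sum_apply, homComp_basis,
    hsum, ← Finset.sum_smul, ← Finset.mul_sum, hc]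
  rw [smul_smul]
  have := compFactor_ne_zero V
  field_simp
  simp

theorem homComp_id [Finite k] {V W : FlagSpace.{v} k} (f : HomSpace V W) :
    homComp V W W f (homId W) = f := by
  induction f using HomSpace.induction with
  | h0 => simp
  | hadd a b ha hb => simp [ha, hb]
  | hsmul c t => ?_
  rw [map_smul, LinearMap.smul_apply]; congr 1
  have e : (Σ d : Differential W, ChainIso t.dTarget d) ≃ autGroup W :=
    { toFun := fun p => ⟨p.2.1, p.2.2.1⟩
      invFun := fun b => ⟨
        { toHom := b.1.toLinearMap ∘ₗ t.dTarget.toHom ∘ₗ b.1.symm.toLinearMap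
          mem := ⟨fun i x hx => autGroup_degree b.2
              (t.dTarget.mem.1 i _ (autGroup_degree (autGroup_symm b.2) hx)), fun i x hx =>
              (b.2.2 i _).2 (t.dTarget.mem.2 i _ (((autGroup_symm b.2).2 (i + 1) x).2 hx))⟩
          sq := fun x => by simp [t.dTarget.sq] }, b.1, b.2, fun x => by simp⟩
      left_inv := by
        rintro ⟨d, b, hb, h⟩
        have hd : b.toLinearMap ∘ₗ t.dTarget.toHom ∘ₗ b.symm.toLinearMap = d.toHom :=
          LinearMap.ext fun x => by simp [h]
        obtain ⟨d, hd1, hd2⟩ := d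
        subst hd
        rfl
      right_inv := fun _ => rfl }
  have hb : ∀ (d : Differential W) (b : ChainIso t.dTarget (Triple.one d).dSource),
      (t.glue (Triple.one d) b).basis = t.basis := fun d b =>
    (Triple.basis_eq (t := t) (t' := t.glue (Triple.one d) b)
      ⟨ChainIso.refl _, b, 0, zero_mem _, fun x => by
        simp [Triple.glue, Triple.one, ChainIso.refl]⟩).symm
  have hc : (∑ d : Differential W, (Fintype.card (ChainIso t.dTarget d) : ℚ)) =
      Nat.card (autGroup W) := by
    rw [← Nat.card_congr e, Nat.card_eq_fintype_card, Fintype.card_sigma, Nat.cast_sum]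
  have hA : (Nat.card (autGroup W) : ℚ) ≠ 0 := Nat.cast_ne_zero.2 Nat.card_pos.ne'
  have hsum : ∀ d : Differential W, t.comp (Triple.one d) =
      (compFactor W * (Fintype.card (ChainIso t.dTarget d) : ℚ)) • t.basis := fun d => by
    unfold Triple.comp
    rw [mul_smul, Finset.sum_congr rfl fun b _ => hb d b, Finset.sum_const, Finset.card_univ,
      Nat.cast_smul_eq_nsmul]
    rfl
  simp only [homId, map_smul, map_sum, homComp_basis,
    hsum, ← Finset.sum_smul, ← Finset.mul_sum, hc]
  rw [smul_smul]
  have := compFactor_ne_zero W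
  field_simp
  simp

/-- The category `ℋ`. -/
instance [Finite k] : Category.{v} (FlagSpace.{v} k) where
  Hom V W := HomSpace V W
  id V := homId V
  comp f g := homComp _ _ _ f g
  id_comp := homId_comp
  comp_id := homComp_id
  assoc := homComp_assoc

instance [Finite k] (V W : FlagSpace.{v} k) : AddCommGroup (V ⟶ W) :=
  inferInstanceAs (AddCommGroup (HomSpace V W))

instance [Finite k] (V W : FlagSpace.{v} k) : Module ℚ (V ⟶ W) :=
  inferInstanceAs (Module ℚ (HomSpace V W))

/-- The `ℚ`-linear structure of `ℋ`. -/
instance [Finite k] : Preadditive (FlagSpace.{v} k) where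
  add_comp U V W f f' g := by
    change homComp U V W (f + f') g = homComp U V W f g + homComp U V W f' g
    rw [map_add, LinearMap.add_apply]
  comp_add U V W f g g' := map_add (homComp U V W f) g g'

instance [Finite k] : Linear ℚ (FlagSpace.{v} k) where
  smul_comp U V W c f g := by
    change homComp U V W (c • f) g = c • homComp U V W f g
    rw [map_smul, LinearMap.smul_apply]
  comp_smul U V W f c g := map_smul (homComp U V W f) c g

/-- The morphism `V ⟶ W` of `ℋ` represented by a triple. -/
def Triple.hom [Finite k] {V W : FlagSpace.{v} k} (t : Triple V W) : V ⟶ W := t.basis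

/-! ### The monoidal product -/

theorem iSup_prod {M N : Type*} {ι : Sort*} [AddCommGroup M] [Module k M] [AddCommGroup N] [Module k N]
    (p : ι → Submodule k M) (q : ι → Submodule k N) :
    ⨆ i, (p i).prod (q i) = (⨆ i, p i).prod (⨆ i, q i) := by
  have h : ∀ (a : Submodule k M) (b : Submodule k N),
      a.prod b = a.map (LinearMap.inl k M N) ⊔ b.map (LinearMap.inr k M N) := fun a b => by
    rw [Submodule.map_inl, Submodule.map_inr, Submodule.prod_sup_prod, sup_bot_eq, bot_sup_eq]
  simp only [h, iSup_sup_eq, Submodule.map_iSup]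

/-- The monoidal product of objects: `V ⊕ W` with the flag
`F₀V ⊂ ⋯ ⊂ F_{dim V}V = V ⊂ V ⊕ F₁W ⊂ ⋯ ⊂ V ⊕ W`. -/
def tensorObj (V W : FlagSpace.{v} k) : FlagSpace.{v} k where
  carrier := V × W
  grading i := (V.grading i).prod (W.grading i)
  isInternal := by
    have hV := (DirectSum.isInternal_submodule_iff_iSupIndep_and_iSup_eq_top _).1 V.isInternal
    have hW := (DirectSum.isInternal_submodule_iff_iSupIndep_and_iSup_eq_top _).1 W.isInternal
    refine (DirectSum.isInternal_submodule_iff_iSupIndep_and_iSup_eq_top _).2 ⟨fun i => ?_, ?_⟩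
    · simp only [iSup_prod]
      rw [disjoint_iff, Submodule.prod_inf_prod, (hV.1 i).eq_bot, (hW.1 i).eq_bot,
        Submodule.prod_bot]
    · rw [iSup_prod, hV.2, hW.2, Submodule.prod_top]
  flag i := (V.flag i).prod (W.flag (i - Module.finrank k V))
  flag_mono _ _ h := Submodule.prod_mono (V.flag_mono h) (W.flag_mono (Nat.sub_le_sub_right h _))
  finrank_flag i := by
    let e : (V.flag i).prod (W.flag (i - Module.finrank k V)) ≃ₗ[k]
        V.flag i × W.flag (i - Module.finrank k V) :=
      { toFun := fun x => (⟨x.1.1, x.2.1⟩, ⟨x.1.2, x.2.2⟩)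
        invFun := fun x => ⟨(x.1.1, x.2.1), x.1.2, x.2.2⟩
        map_add' := fun _ _ => rfl
        map_smul' := fun _ _ => rfl
        left_inv := fun _ => rfl
        right_inv := fun _ => rfl }
    rw [e.finrank_eq, Module.finrank_prod, Module.finrank_prod, V.finrank_flag, W.finrank_flag]
    omega
  flag_graded i := by
    simp only [Submodule.prod_inf_prod, iSup_prod]
    rw [← V.flag_graded, ← W.flag_graded]

/-- The map `U ⊕ X → V ⊕ Y` given by the matrix `[[a, b], [0, c]]`. -/
def blockMap {U V X Y : FlagSpace.{v} k} (a : U →ₗ[k] V) (b : X →ₗ[k] V) (c : X →ₗ[k] Y) :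
    tensorObj U X →ₗ[k] tensorObj V Y :=
  (LinearMap.coprod a b).prod (c ∘ₗ LinearMap.snd k U X)

theorem blockMap_mem {U V X Y : FlagSpace.{v} k} {n : ℤ} {a : U →ₗ[k] V} {b : X →ₗ[k] V}
    {c : X →ₗ[k] Y} (ha : a ∈ gradedHom U V n) (hb : b ∈ gradedHom X V n)
    (hc : c ∈ gradedHom X Y n) :
    blockMap a b c ∈ gradedHom (tensorObj U X) (tensorObj V Y) n := fun i _ hx =>
  ⟨add_mem (ha i _ hx.1) (hb i _ hx.2), hc i _ hx.2⟩

/-- The differential `[[d_U, δ], [0, d_X]]` on `U ⊗ X`. -/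
def blockDifferential {U X : FlagSpace.{v} k} (dU : Differential U) (dX : Differential X)
    (δ : X →ₗ[k] U) (hδ : δ ∈ gradedHom X U 1) (h : ∀ x, dU (δ x) + δ (dX x) = 0) :
    Differential (tensorObj U X) where
  toHom := blockMap dU.toHom δ dX.toHom
  mem := by
    refine ⟨blockMap_mem dU.mem.1 hδ dX.mem.1, ?_⟩
    rintro i ⟨u, x⟩ ⟨hu, hx⟩
    change u ∈ U.flag (i + 1) at hu
    change x ∈ X.flag (i + 1 - Module.finrank k U) at hx
    change dU u + δ x ∈ U.flag i ∧ dX x ∈ X.flag (i - Module.finrank k U)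
    by_cases hi : Module.finrank k U ≤ i
    · rw [U.flag_top hi]
      rw [Nat.sub_add_comm hi] at hx
      exact ⟨Submodule.mem_top, dX.mem.2 _ x hx⟩
    · rw [Nat.sub_eq_zero_of_le (by omega), X.flag_zero, Submodule.mem_bot] at hx
      rw [hx, map_zero, map_zero, add_zero]
      exact ⟨dU.mem.2 i u hu, zero_mem _⟩
  sq := by
    rintro ⟨u, x⟩
    change ((dU (dU u + δ x) + δ (dX x), dX (dX x)) : U × X) = 0
    rw [map_add, dU.sq, dX.sq, zero_add, h]; rfl

/-- The triples `δ = (δ₁₁, δ₁₂, δ₂₂)` over which the sum in the monoidal product is taken. -/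
@[ext]
structure ExtensionDatum {U V X Y : FlagSpace.{v} k} (t : Triple U V) (s : Triple X Y) where
  δ₁₁ : X →ₗ[k] U
  δ₁₂ : X →ₗ[k] V
  δ₂₂ : Y →ₗ[k] V
  mem₁₁ : δ₁₁ ∈ gradedHom X U 1
  mem₁₂ : δ₁₂ ∈ gradedHom X V 0
  mem₂₂ : δ₂₂ ∈ gradedHom Y V 1
  eq₁₁ : ∀ x, t.dSource (δ₁₁ x) + δ₁₁ (s.dSource x) = 0
  eq₂₂ : ∀ y, t.dTarget (δ₂₂ y) + δ₂₂ (s.dTarget y) = 0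
  eq₁₂ : ∀ x, δ₁₂ (s.dSource x) + t.map (δ₁₁ x) = t.dTarget (δ₁₂ x) + δ₂₂ (s.map x)

instance [Finite k] {U V X Y : FlagSpace.{v} k} (t : Triple U V) (s : Triple X Y) :
    Fintype (ExtensionDatum t s) :=
  haveI : Finite (ExtensionDatum t s) :=
    Finite.of_injective (fun δ => (δ.δ₁₁, δ.δ₁₂, δ.δ₂₂)) fun a b h => by
      simp only [Prod.mk.injEq] at h
      exact ExtensionDatum.ext h.1 h.2.1 h.2.2
  Fintype.ofFinite _

/-- The triple `([[d_U, δ₁₁], [0, d_X]], [[f, δ₁₂], [0, g]], [[d_V, δ₂₂], [0, d_Y]])`. -/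
def ExtensionDatum.triple {U V X Y : FlagSpace.{v} k} {t : Triple U V} {s : Triple X Y}
    (δ : ExtensionDatum t s) : Triple (tensorObj U X) (tensorObj V Y) where
  dSource := blockDifferential t.dSource s.dSource δ.δ₁₁ δ.mem₁₁ δ.eq₁₁
  map := blockMap t.map δ.δ₁₂ s.map
  dTarget := blockDifferential t.dTarget s.dTarget δ.δ₂₂ δ.mem₂₂ δ.eq₂₂
  quasiIso := by
    obtain ⟨f0, f1, f2, f3⟩ := (isQuasiIso_iff _ _ _).1 t.quasiIso
    obtain ⟨g0, g1, g2, g3⟩ := (isQuasiIso_iff _ _ _).1 s.quasiIso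
    refine (isQuasiIso_iff _ _ _).2 ⟨blockMap_mem f0 δ.mem₁₂ g0, ?_, ?_, ?_⟩
    · rintro ⟨u, x⟩
      refine Prod.ext ?_ (g1 x)
      change t.map (t.dSource u + δ.δ₁₁ x) + δ.δ₁₂ (s.dSource x) =
        t.dTarget (t.map u + δ.δ₁₂ x) + δ.δ₂₂ (s.map x)
      rw [map_add, map_add, f1, add_assoc, add_assoc, add_comm (t.map _), δ.eq₁₂]
    · rintro ⟨u, x⟩ h ⟨⟨v, y⟩, h'⟩
      have hu : t.dSource u + δ.δ₁₁ x = 0 := congrArg Prod.fst h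
      have hx : s.dSource x = 0 := congrArg Prod.snd h
      have hv : t.dTarget v + δ.δ₂₂ y = t.map u + δ.δ₁₂ x := congrArg Prod.fst h'
      have hy : s.dTarget y = s.map x := congrArg Prod.snd h'
      obtain ⟨x', rfl⟩ := g2 x hx ⟨y, hy⟩
      obtain ⟨x₁, hx₁, y₂, hy₂⟩ := g3 (y - s.map x') (by rw [map_sub, hy, g1, sub_self])
      have e1 := δ.eq₁₂ x₁
      rw [hx₁, map_zero, zero_add] at e1
      have e2 := δ.eq₁₂ x'
      have e3 := δ.eq₂₂ y₂
      have e4 := δ.eq₁₁ x'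
      have e5 := δ.eq₁₁ x₁
      rw [hx₁, map_zero, add_zero] at e5
      have e6 : δ.δ₂₂ (s.map x₁) + δ.δ₂₂ (s.dTarget y₂) = δ.δ₂₂ y - δ.δ₂₂ (s.map x') := by
        rw [← map_add, hy₂, map_sub]
      obtain ⟨u₂, hu₂⟩ := f2 (u - δ.δ₁₁ x' - δ.δ₁₁ x₁) (by
          rw [map_sub, map_sub, e5, sub_zero, eq_neg_of_add_eq_zero_left e4,
            eq_neg_of_add_eq_zero_left hu]; abel)
        ⟨v - δ.δ₂₂ y₂ - δ.δ₁₂ x' - δ.δ₁₂ x₁, by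
          simp only [map_sub]
          linear_combination (norm := abel) hv - e3 + e2 + e1 + e6⟩
      refine ⟨(u₂, x' + x₁), Prod.ext ?_ ?_⟩
      · change t.dSource u₂ + δ.δ₁₁ (x' + x₁) = u
        rw [hu₂, map_add]; abel
      · change s.dSource (x' + x₁) = s.dSource x'
        rw [map_add, hx₁, add_zero]
    · rintro ⟨v, y⟩ h
      have hv : t.dTarget v + δ.δ₂₂ y = 0 := congrArg Prod.fst h
      have hy : s.dTarget y = 0 := congrArg Prod.snd h
      obtain ⟨x₁, hx₁, y₂, hy₂⟩ := g3 y hy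
      have e1 := δ.eq₁₂ x₁
      rw [hx₁, map_zero, zero_add] at e1
      have e3 := δ.eq₂₂ y₂
      have e5 := δ.eq₁₁ x₁
      rw [hx₁, map_zero, add_zero] at e5
      have e6 : δ.δ₂₂ (s.map x₁) + δ.δ₂₂ (s.dTarget y₂) = δ.δ₂₂ y := by
        rw [← map_add, hy₂]
      obtain ⟨u₁, hu₁⟩ := f2 (-δ.δ₁₁ x₁) (by rw [map_neg, e5, neg_zero])
        ⟨v - δ.δ₁₂ x₁ - δ.δ₂₂ y₂, by
          simp only [map_sub, map_neg]
          linear_combination (norm := abel) hv - e3 + e6 + e1⟩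
      have e7 := f1 u₁
      rw [hu₁, map_neg] at e7
      obtain ⟨u₂, hu₂, v₂, hv₂⟩ := f3 (v - t.map u₁ - δ.δ₁₂ x₁ - δ.δ₂₂ y₂) (by
        simp only [map_sub]
        linear_combination (norm := abel) hv - e3 + e6 + e1 + e7)
      refine ⟨(u₁ + u₂, x₁), Prod.ext ?_ hx₁, (v₂, y₂), Prod.ext ?_ hy₂⟩
      · change t.dSource (u₁ + u₂) + δ.δ₁₁ x₁ = 0
        rw [map_add, hu₁, hu₂]; abel
      · change t.map (u₁ + u₂) + δ.δ₁₂ x₁ + (t.dTarget v₂ + δ.δ₂₂ y₂) = v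
        rw [map_add]
        linear_combination (norm := abel) hv₂

/-- The factor
`∏_{i ≥ 0} (|Hom^{-i}(X, U)| |Hom^{-i}(Y, V)| |Hom^{-i-1}(X, V)|)^{(-1)^{i+1}}`. -/
def tensorFactor (U V X Y : FlagSpace.{v} k) : ℚ :=
  ∏ᶠ i : ℕ, ((Nat.card (gradedHom X U (-i)) : ℚ) * Nat.card (gradedHom Y V (-i)) *
    Nat.card (gradedHom X V (-i - 1))) ^ ((-1 : ℤ) ^ (i + 1))

/-- The monoidal product of the basis elements represented by `t` and `s`. -/
def Triple.tensor [Finite k] {U V X Y : FlagSpace.{v} k} (t : Triple U V) (s : Triple X Y) :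
    HomSpace (tensorObj U X) (tensorObj V Y) :=
  tensorFactor U V X Y • ∑ δ : ExtensionDatum t s, (ExtensionDatum.triple δ).basis

theorem prodCongr_mem {U X : FlagSpace.{v} k} {φ : U ≃ₗ[k] U} {ψ : X ≃ₗ[k] X}
    (hφ : φ ∈ autGroup U) (hψ : ψ ∈ autGroup X) :
    (φ.prodCongr ψ : (tensorObj U X) ≃ₗ[k] (tensorObj U X)) ∈ autGroup (tensorObj U X) :=
  ⟨fun i x => and_congr (hφ.1 i x.1) (hψ.1 i x.2), fun i x => and_congr (hφ.2 i x.1) (hψ.2 _ x.2)⟩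

theorem ExtensionDatum.exists_transport {U V X Y : FlagSpace.{v} k} {t t' : Triple U V}
    {s s' : Triple X Y} (ht : t.Equivalent t') (hs : s.Equivalent s') :
    ∃ T : ExtensionDatum t s → ExtensionDatum t' s', Function.Injective T ∧
      ∀ δ : ExtensionDatum t s, δ.triple.Equivalent (T δ).triple := by
  obtain ⟨φ, ψ, h, hh, H⟩ := ht
  obtain ⟨φ', ψ', h', hh', H'⟩ := hs
  simp only [LinearMap.comp_apply, LinearEquiv.coe_coe] at H H'
  have key : ∀ δ : ExtensionDatum t s, ∃ ε : ExtensionDatum t' s',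
      (∀ x, ε.δ₁₁ (φ'.1 x) = φ.1 (δ.δ₁₁ x)) ∧ (∀ y, ε.δ₂₂ (ψ'.1 y) = ψ.1 (δ.δ₂₂ y)) ∧
      ∀ x, ε.δ₁₂ (φ'.1 x) = ψ.1 (δ.δ₁₂ x) - ε.δ₂₂ (h' x) - h (δ.δ₁₁ x) := by
    intro δ
    set ε₁ : X →ₗ[k] U := φ.1.toLinearMap ∘ₗ δ.δ₁₁ ∘ₗ φ'.symm.1.toLinearMap with hε₁
    set ε₂ : Y →ₗ[k] V := ψ.1.toLinearMap ∘ₗ δ.δ₂₂ ∘ₗ ψ'.symm.1.toLinearMap with hε₂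
    set ε : X →ₗ[k] V := (ψ.1.toLinearMap ∘ₗ δ.δ₁₂ - ε₂ ∘ₗ h' - h ∘ₗ δ.δ₁₁) ∘ₗ
      φ'.symm.1.toLinearMap with hε
    have r1 : ∀ x, ε₁ (φ'.1 x) = φ.1 (δ.δ₁₁ x) := fun x => by
      change φ.1 (δ.δ₁₁ (φ'.1.symm (φ'.1 x))) = _
      rw [LinearEquiv.symm_apply_apply]
    have r2 : ∀ y, ε₂ (ψ'.1 y) = ψ.1 (δ.δ₂₂ y) := fun y => by
      change ψ.1 (δ.δ₂₂ (ψ'.1.symm (ψ'.1 y))) = _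
      rw [LinearEquiv.symm_apply_apply]
    have r3 : ∀ x, ε (φ'.1 x) = ψ.1 (δ.δ₁₂ x) - ε₂ (h' x) - h (δ.δ₁₁ x) := fun x => by
      change (ψ.1.toLinearMap ∘ₗ δ.δ₁₂ - ε₂ ∘ₗ h' - h ∘ₗ δ.δ₁₁) (φ'.1.symm (φ'.1 x)) = _
      rw [LinearEquiv.symm_apply_apply]; rfl
    have m1 : ε₁ ∈ gradedHom X U 1 :=
      gradedHom_comp (gradedHom_comp φ'.symm.degree δ.mem₁₁ rfl) φ.degree rfl
    have m2 : ε₂ ∈ gradedHom Y V 1 :=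
      gradedHom_comp (gradedHom_comp ψ'.symm.degree δ.mem₂₂ rfl) ψ.degree rfl
    have m3 : ε ∈ gradedHom X V 0 := gradedHom_comp φ'.symm.degree
      (sub_mem (sub_mem (gradedHom_comp δ.mem₁₂ ψ.degree rfl) (gradedHom_comp hh' m2 rfl))
        (gradedHom_comp δ.mem₁₁ hh rfl)) rfl
    have q1 : ∀ x, t'.dSource (ε₁ x) + ε₁ (s'.dSource x) = 0 := fun x => by
      obtain ⟨x, rfl⟩ := φ'.1.surjective x
      rw [r1, ← φ'.2.2, r1, ← φ.2.2, ← map_add, δ.eq₁₁, map_zero]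
    have q2 : ∀ y, t'.dTarget (ε₂ y) + ε₂ (s'.dTarget y) = 0 := fun y => by
      obtain ⟨y, rfl⟩ := ψ'.1.surjective y
      rw [r2, ← ψ'.2.2, r2, ← ψ.2.2, ← map_add, δ.eq₂₂, map_zero]
    refine ⟨⟨ε₁, ε, ε₂, m1, m3, m2, q1, q2, fun x => ?_⟩, r1, r2, r3⟩
    obtain ⟨x, rfl⟩ := φ'.1.surjective x
    rw [← φ'.2.2, r3, r3, r1]
    have a1 := H (δ.δ₁₁ x)
    have a2 := congrArg ε₂ (H' x)
    have a3 := congrArg ψ.1 (δ.eq₁₂ x)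
    have a4 := q2 (h' x)
    have a5 := congrArg h (δ.eq₁₁ x)
    have a6 := r2 (s.map x)
    have a7 := ψ.2.2 (δ.δ₁₂ x)
    simp only [map_add, map_sub, map_zero] at a1 a2 a3 a4 a5 ⊢
    linear_combination (norm := abel) a3 - a1 + a2 + a4 - a5 - a6 + a7
  choose T hT using key
  refine ⟨T, fun δ₁ δ₂ e => ?_, fun δ => ?_⟩
  · obtain ⟨p1, p2, p3⟩ := hT δ₁
    obtain ⟨p1', p2', p3'⟩ := hT δ₂
    rw [e] at p1 p2 p3
    have e1 : δ₁.δ₁₁ = δ₂.δ₁₁ := LinearMap.ext fun x =>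
      φ.1.injective ((p1 x).symm.trans (p1' x))
    refine ExtensionDatum.ext e1 (LinearMap.ext fun x => ψ.1.injective ?_)
      (LinearMap.ext fun y => ψ.1.injective ((p2 y).symm.trans (p2' y)))
    have := (p3 x).symm.trans (p3' x)
    rw [e1] at this
    exact sub_left_injective (sub_left_injective this)
  · obtain ⟨p1, p2, p3⟩ := hT δ
    refine ⟨⟨φ.1.prodCongr φ'.1, prodCongr_mem φ.2.1 φ'.2.1, ?_⟩,
      ⟨ψ.1.prodCongr ψ'.1, prodCongr_mem ψ.2.1 ψ'.2.1, ?_⟩, blockMap h 0 h',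
      blockMap_mem hh (zero_mem _) hh', ?_⟩
    · rintro ⟨u, x⟩
      refine Prod.ext ?_ (φ'.2.2 x)
      change φ.1 (t.dSource u + δ.δ₁₁ x) = t'.dSource (φ.1 u) + (T δ).δ₁₁ (φ'.1 x)
      rw [map_add, φ.2.2, p1]
    · rintro ⟨u, x⟩
      refine Prod.ext ?_ (ψ'.2.2 x)
      change ψ.1 (t.dTarget u + δ.δ₂₂ x) = t'.dTarget (ψ.1 u) + (T δ).δ₂₂ (ψ'.1 x)
      rw [map_add, ψ.2.2, p2]
    · rintro ⟨u, x⟩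
      refine Prod.ext ?_ (H' x)
      change ψ.1 (t.map u + δ.δ₁₂ x) - (t'.map (φ.1 u) + (T δ).δ₁₂ (φ'.1 x)) =
        t'.dTarget (h u + (0 : X →ₗ[k] V) x) + (T δ).δ₂₂ (h' x) +
          (h (t.dSource u + δ.δ₁₁ x) + (0 : X →ₗ[k] V) (s.dSource x))
      have a1 := H u
      rw [p3]
      simp only [map_add, LinearMap.zero_apply, map_zero]
      linear_combination (norm := abel) a1

theorem Triple.tensor_congr [Finite k] {U V X Y : FlagSpace.{v} k} {t t' : Triple U V}
    {s s' : Triple X Y} (ht : t.Equivalent t') (hs : s.Equivalent s') :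
    t.tensor s = t'.tensor s' := by
  obtain ⟨T, hT, hT'⟩ := ExtensionDatum.exists_transport ht hs
  obtain ⟨S, hS, -⟩ := ExtensionDatum.exists_transport
    ((tripleSetoid U V).iseqv.symm ht) ((tripleSetoid X Y).iseqv.symm hs)
  have hb : Function.Bijective T := (Fintype.bijective_iff_injective_and_card T).2
    ⟨hT, le_antisymm (Fintype.card_le_of_injective T hT) (Fintype.card_le_of_injective S hS)⟩
  unfold Triple.tensor
  congr 1
  exact Fintype.sum_bijective T hb _ _ fun δ => Triple.basis_eq (hT' δ)

/-- The monoidal product of morphisms, as a bilinear map. -/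
def tensorMap [Finite k] (U V X Y : FlagSpace.{v} k) :
    (U ⟶ V) →ₗ[ℚ] (X ⟶ Y) →ₗ[ℚ] (tensorObj U X ⟶ tensorObj V Y) :=
  bilinearExtend (M := HomSpace (tensorObj U X) (tensorObj V Y)) fun a b =>
    Quotient.liftOn₂ a b Triple.tensor fun _ _ _ _ => Triple.tensor_congr

/-! ### The duality -/

/-- `s` is of the form `(d_W, f', d_V)` for `t = (d_V, f, d_W)`, with `f'` inverse to `f` up to
homotopy. -/
def Triple.IsDual {V W : FlagSpace.{v} k} (t : Triple V W) (s : Triple W V) : Prop :=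
  s.dSource = t.dTarget ∧ s.dTarget = t.dSource ∧
    Homotopic t.dSource t.dSource (s.map ∘ₗ t.map) LinearMap.id ∧
    Homotopic t.dTarget t.dTarget (t.map ∘ₗ s.map) LinearMap.id

/-- A family of linear maps `Hom(V, W) → Hom(W, V)` preserving identities and reversing
composition, as a contravariant functor which is the identity on objects. -/
def contravariantFunctor [Finite k] (D : ∀ V W : FlagSpace.{v} k, (V ⟶ W) →ₗ[ℚ] (W ⟶ V))
    (hid : ∀ V, D V V (𝟙 V) = 𝟙 V)
    (hcomp : ∀ (U V W : FlagSpace.{v} k) (f : U ⟶ V) (g : V ⟶ W),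
      D U W (f ≫ g) = D V W g ≫ D U V f) :
    (FlagSpace.{v} k)ᵒᵖ ⥤ FlagSpace.{v} k where
  obj V := V.unop
  map {V W} f := D W.unop V.unop f.unop
  map_id V := hid V.unop
  map_comp f g := hcomp _ _ _ g.unop f.unop

end HallFlag

end

/-!
The functor `D` replaces a quasi-isomorphism by a homotopy inverse.

*Existence of inverses.* The cone of a quasi-isomorphism `f` is an acyclic complex of graded vector
spaces, so it has a graded contraction (`exists_contraction`); the entries of the contraction are a
homotopy inverse of `f` together with both homotopies (`IsQuasiIso.exists_homotopyInverse`).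
Homotopy inverses are unique up to homotopy, so the class of the dual triple depends only on the
class of the triple (`Triple.IsDual.equivalent`), and `D` is determined by its values on triples.

*Functoriality.* A homotopy inverse of `g b f` is `f' b⁻¹ g'`, and `b ↦ b⁻¹` is a bijection between
the index sets of the sums defining `g ∘ f` and `D f ∘ D g`; the factor depends on the middle object
only. Since `D ∘ D = 1`, the functor `D` is an equivalence.

*Monoidal product.* The data `δ` for `(f, g)` and `δ'` for `(f', g')` are compared by a relation
(`ExtensionDatum.Related`) which exchanges `δ₁₁` and `δ₂₂` and makes the block matrices
of `δ` and `δ'` homotopy inverse to each other. For given `δ` the possible entries `δ'₁₂` form a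
torsor under the coboundaries `B⁰(Y, U)` of the complex `Hom^•(Y, U)`; for given `δ'` the possible
entries `δ₁₂` form a torsor under `B⁰(X, V)`. Both facts are instances of
`IsHomQuasiIso.card_lifts`, applied to composition with `g` and with `f'`. Double counting shows
that the two sums differ by the factor `|B⁰(X, V)| / |B⁰(Y, U)|`. By `|Homⁿ| = |Zⁿ| |Bⁿ⁺¹|` and
`H^•(Hom(X, V)) ≅ H^•(Hom(Y, U))`, this is precisely the inverse of the quotient of the two
normalizing factors (`tensorFactor_mul_card_coboundaries`).
-/

namespace HallFlag

variable {k : Type u} [Field k]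

/-! ### Graded contractions of acyclic complexes -/

section Contraction

variable {M N : Type*} [AddCommGroup M] [Module k M] [AddCommGroup N] [Module k N]
  {G : ℤ → Submodule k M}

/-- Linear maps on the graded pieces assemble to a linear map on the whole space. -/
theorem exists_linearMap_of_isInternal (hG : DirectSum.IsInternal G) (φ : ∀ i, G i →ₗ[k] N) :
    ∃ ψ : M →ₗ[k] N, ∀ i (x : G i), ψ x = φ i x := by
  let e := LinearEquiv.ofBijective (DirectSum.coeLinearMap G) hG
  refine ⟨DirectSum.toModule k ℤ N φ ∘ₗ e.symm.toLinearMap, fun i x => ?_⟩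
  have h : e.symm x = DirectSum.lof k ℤ (fun i => G i) i x := by
    rw [LinearEquiv.symm_apply_eq]
    exact (DirectSum.coeLinearMap_lof G i x).symm
  rw [LinearMap.comp_apply, LinearEquiv.coe_coe, h, DirectSum.toModule_lof]

theorem linearMap_ext_of_isInternal (hG : DirectSum.IsInternal G) {f g : M →ₗ[k] N}
    (h : ∀ i, ∀ x ∈ G i, f x = g x) : f = g := by
  have hle : ⨆ i, G i ≤ LinearMap.eqLocus f g := iSup_le h
  rw [hG.submodule_iSup_eq_top] at hle
  exact LinearMap.ext fun x => hle Submodule.mem_top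

/-- Over a field every linear map `T` has a generalized inverse `S` with `T S T = T`. -/
theorem exists_pseudoinverse (T : M →ₗ[k] N) : ∃ S : N →ₗ[k] M, ∀ x, T (S (T x)) = T x := by
  obtain ⟨s, hs⟩ := T.rangeRestrict.exists_rightInverse_of_surjective T.range_rangeRestrict
  obtain ⟨S, hS⟩ := s.exists_extend
  refine ⟨S, fun x => ?_⟩
  have h1 : S (T x) = s (T.rangeRestrict x) := LinearMap.congr_fun hS (T.rangeRestrict x)
  rw [h1]
  exact congrArg Subtype.val (LinearMap.congr_fun hs (T.rangeRestrict x))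

/-- A homogeneous map of degree `1` has a generalized inverse of degree `-1`, assembled from
generalized inverses of its graded pieces. -/
theorem exists_graded_pseudoinverse (hG : DirectSum.IsInternal G) (D : M →ₗ[k] M)
    (hD : ∀ i, ∀ x ∈ G i, D x ∈ G (i + 1)) :
    ∃ e : M →ₗ[k] M, (∀ i, ∀ x ∈ G i, e x ∈ G (i - 1)) ∧ ∀ x, D (e (D x)) = D x := by
  have hD' : ∀ i, ∀ x ∈ G (i - 1), D x ∈ G i := fun i x hx => by
    simpa using hD (i - 1) x hx
  choose S hS using fun i => exists_pseudoinverse (D.restrict (hD' i))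
  obtain ⟨e, he⟩ := exists_linearMap_of_isInternal hG fun i => (G (i - 1)).subtype ∘ₗ S i
  refine ⟨e, fun i x hx => ?_, ?_⟩
  · rw [he i ⟨x, hx⟩]
    exact (S i ⟨x, hx⟩).2
  · refine LinearMap.congr_fun (f := D ∘ₗ e ∘ₗ D) (linearMap_ext_of_isInternal hG fun i x hx => ?_)
    have hx' : x ∈ G (i + 1 - 1) := by rwa [add_sub_cancel_right]
    have h1 := congrArg Subtype.val (hS (i + 1) ⟨x, hx'⟩)
    have h2 := he (i + 1) ⟨D x, hD' _ x hx'⟩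
    change D (e (D x)) = D x
    rw [h2]
    exact h1

/-- If `D e D = D` and `ker D = im D`, then `e - e e D` is a contraction: `x - e D x` is a cycle,
hence fixed by `D e`. -/
theorem exists_contraction (hG : DirectSum.IsInternal G) (D : M →ₗ[k] M)
    (hD : ∀ i, ∀ x ∈ G i, D x ∈ G (i + 1)) (hsq : ∀ x, D (D x) = 0)
    (hex : ∀ x, D x = 0 → ∃ y, D y = x) :
    ∃ h : M →ₗ[k] M, (∀ i, ∀ x ∈ G i, h x ∈ G (i - 1)) ∧ ∀ x, D (h x) + h (D x) = x := by
  obtain ⟨e, he, hDe⟩ := exists_graded_pseudoinverse hG D hD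
  refine ⟨e - e ∘ₗ e ∘ₗ D, fun i x hx => sub_mem (he i x hx) ?_, fun x => ?_⟩
  · have := he _ _ (he _ _ (hD i x hx))
    rwa [add_sub_cancel_right] at this
  · obtain ⟨y, hy⟩ := hex (x - e (D x)) (by rw [map_sub, hDe, sub_self])
    have h1 := hDe y
    rw [hy, map_sub, map_sub] at h1
    simp only [LinearMap.sub_apply, LinearMap.comp_apply, map_sub, hsq, map_zero, sub_zero]
    rw [h1, sub_add_cancel]

end Contraction

/-! ### Homotopy inverses -/

/-- A quasi-isomorphism of complexes of graded vector spaces is a homotopy equivalence. The cone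
of `f` is acyclic, hence has a graded contraction, whose matrix entries are a homotopy inverse of
`f` and the two homotopies. -/
theorem IsQuasiIso.exists_homotopyInverse {V W : FlagSpace.{v} k} {d : Differential V}
    {d' : Differential W} {f : V →ₗ[k] W} (hf : IsQuasiIso d d' f) :
    ∃ g ∈ gradedHom W V 0, (∀ y, g (d' y) = d (g y)) ∧
      Homotopic d d (g ∘ₗ f) LinearMap.id ∧ Homotopic d' d' (f ∘ₗ g) LinearMap.id := by
  obtain ⟨f0, f1, f2, f3⟩ := (isQuasiIso_iff _ _ _).1 hf
  have hV := (DirectSum.isInternal_submodule_iff_iSupIndep_and_iSup_eq_top _).1 V.isInternal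
  have hW := (DirectSum.isInternal_submodule_iff_iSupIndep_and_iSup_eq_top _).1 W.isInternal
  have hV' : iSupIndep fun i : ℤ => V.grading (i + 1) := hV.1.comp (add_left_injective 1)
  have hV'' : ⨆ i : ℤ, V.grading (i + 1) = ⊤ := by
    rw [← hV.2]; exact (Equiv.addRight (1 : ℤ)).iSup_comp (g := V.grading)
  have hG : DirectSum.IsInternal fun i : ℤ => (V.grading (i + 1)).prod (W.grading i) := by
    refine (DirectSum.isInternal_submodule_iff_iSupIndep_and_iSup_eq_top _).2 ⟨fun i => ?_, ?_⟩
    · simp only [iSup_prod]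
      rw [disjoint_iff, Submodule.prod_inf_prod, (hV' i).eq_bot, (hW.1 i).eq_bot,
        Submodule.prod_bot]
    · rw [iSup_prod, hV'', hW.2, Submodule.prod_top]
  -- The cone has degree `i` part `Vᵢ₊₁ ⊕ Wᵢ` and differential `(v, w) ↦ (-d v, f v + d' w)`.
  let D : (V × W) →ₗ[k] (V × W) :=
    (-(d.toHom ∘ₗ LinearMap.fst k V W)).prod (LinearMap.coprod f d'.toHom)
  have hDa : ∀ v w, D (v, w) = (-d v, f v + d' w) := fun _ _ => rfl
  obtain ⟨h, hh, H⟩ := exists_contraction hG D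
    (by
      rintro i ⟨v, w⟩ ⟨hv, hw⟩
      refine ⟨neg_mem (d.mem.1 _ _ hv), add_mem ?_ (d'.mem.1 _ _ hw)⟩
      simpa using f0 _ _ hv)
    (by
      rintro ⟨v, w⟩
      rw [hDa, hDa, map_neg, d.sq, map_neg, f1, map_add, d'.sq]
      simp)
    (by
      rintro ⟨v, w⟩ hvw
      have h1 : -d v = 0 := congrArg Prod.fst hvw
      have h2 : f v + d' w = 0 := congrArg Prod.snd hvw
      obtain ⟨z, rfl⟩ := f2 v (neg_eq_zero.1 h1)
        ⟨-w, by rw [map_neg]; exact (eq_neg_of_add_eq_zero_left h2).symm⟩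
      obtain ⟨x, hx, z', hz'⟩ := f3 (f z + w) (by rw [map_add, ← f1, h2])
      refine ⟨(x - z, z'), ?_⟩
      rw [hDa, map_sub, map_sub, hx, zero_sub, neg_neg, sub_add_eq_add_sub, hz',
        add_sub_cancel_left])
  -- The matrix entries of the contraction: `g` is the homotopy inverse, `p` and `-r` are the
  -- homotopies.
  let p : V →ₗ[k] V := LinearMap.fst k V W ∘ₗ h ∘ₗ LinearMap.inl k V W
  let g : W →ₗ[k] V := LinearMap.fst k V W ∘ₗ h ∘ₗ LinearMap.inr k V W
  let q : V →ₗ[k] W := LinearMap.snd k V W ∘ₗ h ∘ₗ LinearMap.inl k V W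
  let r : W →ₗ[k] W := LinearMap.snd k V W ∘ₗ h ∘ₗ LinearMap.inr k V W
  have hha : ∀ v w, h (v, w) = (p v + g w, q v + r w) := fun v w => by
    have : ((v, w) : V × W) = (v, 0) + (0, w) := by simp
    rw [this, map_add]; rfl
  have Hv : ∀ v, g (f v) - v = d (p v) + p (d v) := fun v => by
    have := congrArg Prod.fst (H (v, 0))
    simp only [hDa, hha, map_zero, add_zero, map_neg, Prod.fst_add] at this
    linear_combination (norm := abel) this
  have Hw : ∀ w, g (d' w) = d (g w) ∧ f (g w) - w = -(d' (r w) + r (d' w)) := fun w => by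
    have h1 := congrArg Prod.fst (H (0, w))
    have h2 := congrArg Prod.snd (H (0, w))
    simp only [hDa, hha, map_zero, zero_add, neg_zero, Prod.fst_add, Prod.snd_add]
      at h1 h2
    constructor
    · linear_combination (norm := abel) h1
    · linear_combination (norm := abel) h2
  refine ⟨g, fun i y hy => ?_, fun y => (Hw y).1, ⟨p, fun i x hx => ?_, Hv⟩,
    -r, neg_mem fun i y hy => (hh i (0, y) ⟨zero_mem _, hy⟩).2, fun y => ?_⟩
  · have := (hh i (0, y) ⟨zero_mem _, hy⟩).1
    rw [sub_add_cancel] at this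
    rw [add_zero]; exact this
  · have := (hh (i - 1) (x, 0) ⟨by rwa [sub_add_cancel], zero_mem _⟩).1
    rw [sub_add_cancel] at this
    exact this
  · rw [LinearMap.comp_apply, LinearMap.id_apply, (Hw y).2, LinearMap.neg_apply,
      LinearMap.neg_apply, map_neg, neg_add]

section Homotopic

variable {U V W : FlagSpace.{v} k} {d : Differential U} {d' : Differential V}
  {d'' : Differential W}

theorem Homotopic.symm {f g : U →ₗ[k] V} (H : Homotopic d d' f g) : Homotopic d d' g f := by
  obtain ⟨h, hh, H⟩ := H
  refine ⟨-h, neg_mem hh, fun x => ?_⟩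
  rw [← neg_sub, H, LinearMap.neg_apply, LinearMap.neg_apply, map_neg, neg_add]

theorem Homotopic.trans {f g e : U →ₗ[k] V} (H : Homotopic d d' f g) (H' : Homotopic d d' g e) :
    Homotopic d d' f e := by
  obtain ⟨h, hh, H⟩ := H
  obtain ⟨h', hh', H'⟩ := H'
  refine ⟨h + h', add_mem hh hh', fun x => ?_⟩
  rw [← sub_add_sub_cancel _ (g x), H, H', LinearMap.add_apply, LinearMap.add_apply, map_add]
  abel

theorem Homotopic.comp_left {f g : U →ₗ[k] V} (H : Homotopic d d' f g) {e : V →ₗ[k] W}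
    (he : IsQuasiIso d' d'' e) : Homotopic d d'' (e ∘ₗ f) (e ∘ₗ g) := by
  obtain ⟨h, hh, H⟩ := H
  obtain ⟨e0, e1, -⟩ := he
  refine ⟨e ∘ₗ h, gradedHom_comp hh e0 (by norm_num), fun x => ?_⟩
  simp only [LinearMap.comp_apply]
  rw [← map_sub, H, map_add, e1]

theorem Homotopic.comp_right {f g : V →ₗ[k] W} (H : Homotopic d' d'' f g) {e : U →ₗ[k] V}
    (he : IsQuasiIso d d' e) : Homotopic d d'' (f ∘ₗ e) (g ∘ₗ e) := by
  obtain ⟨h, hh, H⟩ := H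
  obtain ⟨e0, e1, -⟩ := he
  refine ⟨h ∘ₗ e, gradedHom_comp e0 hh (by norm_num), fun x => ?_⟩
  simp only [LinearMap.comp_apply]
  rw [H, e1]

theorem isQuasiIso_of_homotopyInverse {f : U →ₗ[k] V} {g : V →ₗ[k] U} (hf0 : f ∈ gradedHom U V 0)
    (hf : ∀ x, f (d x) = d' (f x)) (hg : ∀ y, g (d' y) = d (g y))
    (H : Homotopic d d (g ∘ₗ f) LinearMap.id) (H' : Homotopic d' d' (f ∘ₗ g) LinearMap.id) :
    IsQuasiIso d d' f := by
  obtain ⟨h, -, H⟩ := H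
  obtain ⟨h', -, H'⟩ := H'
  simp only [LinearMap.comp_apply, LinearMap.id_apply] at H H'
  refine (isQuasiIso_iff _ _ _).2 ⟨hf0, hf, ?_, fun y hy => ?_⟩
  · rintro x hx ⟨y, hy⟩
    have h1 := H x
    refine ⟨g y - h x, ?_⟩
    rw [hx, map_zero, add_zero] at h1
    rw [map_sub, ← hg, hy, ← h1, sub_sub_cancel]
  · have h1 := H' y
    refine ⟨g y, by rw [← hg, hy, map_zero], -h' y, ?_⟩
    rw [hy, map_zero, add_zero] at h1
    rw [map_neg, ← h1, neg_sub, add_sub_cancel]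

end Homotopic

/-! ### Duals of triples -/

theorem Triple.exists_isDual_eq {V W : FlagSpace.{v} k} (t : Triple V W) :
    ∃ g : W →ₗ[k] V, ∃ hg : IsQuasiIso t.dTarget t.dSource g,
      t.IsDual ⟨t.dTarget, g, t.dSource, hg⟩ := by
  obtain ⟨g, g0, g1, H, H'⟩ := t.quasiIso.exists_homotopyInverse
  exact ⟨g, isQuasiIso_of_homotopyInverse g0 g1 t.comm H' H, rfl, rfl, H, H'⟩

/-- A dual `(d_W, f', d_V)` of the triple `(d_V, f, d_W)`, with a chosen homotopy inverse `f'` of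
`f`; its differentials are those of the given triple by definition. -/
noncomputable def Triple.dual {V W : FlagSpace.{v} k} (t : Triple V W) : Triple W V :=
  ⟨t.dTarget, t.exists_isDual_eq.choose, t.dSource, t.exists_isDual_eq.choose_spec.choose⟩

theorem Triple.isDual_dual {V W : FlagSpace.{v} k} (t : Triple V W) : t.IsDual t.dual :=
  t.exists_isDual_eq.choose_spec.choose_spec

theorem Triple.IsDual.symm {V W : FlagSpace.{v} k} {t : Triple V W} {s : Triple W V}
    (h : t.IsDual s) : s.IsDual t := by
  obtain ⟨d₁, f, d₂, hf⟩ := t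
  obtain ⟨d₃, g, d₄, hg⟩ := s
  obtain ⟨h1, h2, h3, h4⟩ := h
  subst h1 h2
  exact ⟨rfl, rfl, h4, h3⟩

/-- A left homotopy inverse is a homotopy inverse, because some homotopy inverse exists. -/
theorem Triple.isDual_of_left {V W : FlagSpace.{v} k} {t : Triple V W} {s : Triple W V}
    (h1 : s.dSource = t.dTarget) (h2 : s.dTarget = t.dSource)
    (H : Homotopic t.dSource t.dSource (s.map ∘ₗ t.map) LinearMap.id) : t.IsDual s := by
  obtain ⟨-, -, -, H₂⟩ := t.isDual_dual
  obtain ⟨d₁, f, d₂, hf⟩ := t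
  obtain ⟨d₃, g, d₄, hg⟩ := s
  subst h1 h2
  -- With a two-sided inverse `f'` of `f`: `g ∼ g f f' ∼ f'`, hence `f g ∼ f f' ∼ 1`.
  refine ⟨rfl, rfl, H, Homotopic.trans ?_ H₂⟩
  refine Homotopic.comp_left (d' := d₄) ?_ hf
  exact ((H₂.symm.comp_left hg).trans (H.comp_right (Triple.dual ⟨_, f, _, hf⟩).quasiIso))

/-- Homotopy inverses of equivalent triples are equivalent; in particular a homotopy inverse is
unique up to equivalence. -/
theorem Triple.IsDual.equivalent {V W : FlagSpace.{v} k} {t t' : Triple V W} {s s' : Triple W V}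
    (hs : t.IsDual s) (hs' : t'.IsDual s') (h : t.Equivalent t') : s.Equivalent s' := by
  obtain ⟨d₁, f, d₂, hf⟩ := t
  obtain ⟨d₁', f', d₂', hf'⟩ := t'
  obtain ⟨d₃, g, d₄, hg⟩ := s
  obtain ⟨d₃', g', d₄', hg'⟩ := s'
  obtain ⟨h1, h2, -, H⟩ := hs
  obtain ⟨h1', h2', H', -⟩ := hs'
  subst h1 h2 h1' h2'
  obtain ⟨φ, ψ, K⟩ := h
  refine ⟨ψ, φ, ?_⟩
  -- `φ g ∼ g' f' φ g ∼ g' ψ f g ∼ g' ψ`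
  have a1 := (H'.comp_right (φ.isQuasiIso.comp hg)).symm
  have a2 := (K.symm.comp_right hg).comp_left hg'
  have a3 := (H.comp_left ψ.isQuasiIso).comp_left hg'
  exact a1.trans (a2.trans a3)

theorem Triple.isDual_one {V : FlagSpace.{v} k} (d : Differential V) :
    (Triple.one d).IsDual (Triple.one d) :=
  ⟨rfl, rfl, ⟨0, zero_mem _, fun x => by simp [Triple.one]⟩,
    0, zero_mem _, fun x => by simp [Triple.one]⟩

theorem Triple.isDual_glue {U V W : FlagSpace.{v} k} (t : Triple U V) (s : Triple V W)
    (b : ChainIso t.dTarget s.dSource) :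
    (t.glue s b).IsDual (s.dual.glue t.dual b.symm) := by
  obtain ⟨-, -, Ht, -⟩ := t.isDual_dual
  obtain ⟨-, -, Hs, -⟩ := s.isDual_dual
  refine Triple.isDual_of_left rfl rfl ?_
  -- `f' b⁻¹ g' g b f ∼ f' b⁻¹ b f = f' f ∼ 1`
  have a1 := ((Hs.comp_right (b.isQuasiIso.comp t.quasiIso)).comp_left
    b.symm.isQuasiIso).comp_left t.dual.quasiIso
  refine Homotopic.trans a1 ?_
  have a2 : t.dual.map ∘ₗ b.symm.1.toLinearMap ∘ₗ LinearMap.id ∘ₗ b.1.toLinearMap ∘ₗ t.map =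
      t.dual.map ∘ₗ t.map :=
    LinearMap.ext fun x => congrArg t.dual.map (b.1.symm_apply_apply (t.map x))
  rw [a2]
  exact Ht

/-- Inversion of isomorphisms of complexes, as a bijection. -/
def ChainIso.symmEquiv {V : FlagSpace.{v} k} (d d' : Differential V) :
    ChainIso d d' ≃ ChainIso d' d where
  toFun := ChainIso.symm
  invFun := ChainIso.symm
  left_inv _ := rfl
  right_inv _ := rfl

/-! ### The duality functor -/

/-- The linear map `(d_V, f, d_W) ↦ (d_W, f', d_V)` on Hom-spaces. -/
noncomputable def dualMap (V W : FlagSpace.{v} k) : HomSpace V W →ₗ[ℚ] HomSpace W V :=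
  Finsupp.linearCombination ℚ fun a => Quotient.liftOn a (fun t => t.dual.basis) fun t t' h =>
    Triple.basis_eq (t.isDual_dual.equivalent t'.isDual_dual h)

theorem dualMap_basis {V W : FlagSpace.{v} k} {t : Triple V W} {s : Triple W V}
    (h : t.IsDual s) : dualMap V W t.basis = s.basis := by
  refine Eq.trans (by simp [dualMap, Triple.basis]) (Triple.basis_eq (t := t.dual)
    (t.isDual_dual.equivalent h ((tripleSetoid V W).iseqv.refl t)))

theorem dualMap_dualMap {V W : FlagSpace.{v} k} (f : HomSpace V W) :
    dualMap W V (dualMap V W f) = f := by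
  induction f using HomSpace.induction with
  | h0 => simp
  | hadd a b ha hb => simp [ha, hb]
  | hsmul c t =>
    rw [map_smul, map_smul, dualMap_basis t.isDual_dual, dualMap_basis t.isDual_dual.symm]

theorem dualMap_homId [Finite k] (V : FlagSpace.{v} k) : dualMap V V (homId V) = homId V := by
  rw [homId, map_smul, map_sum]
  simp only [dualMap_basis (Triple.isDual_one _)]

theorem dualMap_homComp [Finite k] {U V W : FlagSpace.{v} k} (f : HomSpace U V)
    (g : HomSpace V W) :
    dualMap U W (homComp U V W f g) = homComp W V U (dualMap V W g) (dualMap U V f) := by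
  induction f using HomSpace.induction with
  | h0 => simp
  | hadd a b ha hb => simp [ha, hb]
  | hsmul c t => ?_
  induction g using HomSpace.induction with
  | h0 => simp
  | hadd a b ha hb => simpa using congrArg₂ (· + ·) ha hb
  | hsmul c' s => ?_
  simp only [map_smul, LinearMap.smul_apply, homComp_basis, dualMap_basis (Triple.isDual_dual _)]
  rw [smul_comm]
  congr 2
  unfold Triple.comp
  rw [map_smul, map_sum]
  congr 1
  exact Fintype.sum_equiv (ChainIso.symmEquiv _ _) _ _ fun b => dualMap_basis (t.isDual_glue s b)

/-- `dualMap` on the morphisms of `ℋ`. -/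
noncomputable def dualHom [Finite k] (V W : FlagSpace.{v} k) : (V ⟶ W) →ₗ[ℚ] (W ⟶ V) :=
  dualMap V W

theorem isEquivalence_contravariantFunctor_dualHom [Finite k]
    (hid : ∀ V : FlagSpace.{v} k, dualHom V V (𝟙 V) = 𝟙 V)
    (hcomp : ∀ (U V W : FlagSpace.{v} k) (f : U ⟶ V) (g : V ⟶ W),
      dualHom U W (f ≫ g) = dualHom V W g ≫ dualHom U V f) :
    (contravariantFunctor dualHom hid hcomp).IsEquivalence where
  faithful := ⟨fun h => Quiver.Hom.unop_inj
    ((dualMap_dualMap _).symm.trans ((congrArg (dualMap _ _) h).trans (dualMap_dualMap _)))⟩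
  full := ⟨fun g => ⟨Quiver.Hom.op (dualMap _ _ g), dualMap_dualMap _⟩⟩
  essSurj := ⟨fun V => ⟨Opposite.op V, ⟨Iso.refl _⟩⟩⟩

/-! ### Double counting -/

/-- If `R` relates each `a` to exactly `m` elements `b` and each `b` to exactly `n` elements `a`,
and `u a = u' b` for related elements, then the sums of `u` and `u'` are proportional. -/
theorem smul_sum_eq_smul_sum_of_card_eq {α β M : Type*} [Fintype α] [Fintype β]
    [AddCommMonoid M] {R : α → β → Prop} {u : α → M} {u' : β → M} {m n : ℕ}
    (hm : ∀ a, Nat.card {b // R a b} = m) (hn : ∀ b, Nat.card {a // R a b} = n)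
    (hu : ∀ a b, R a b → u a = u' b) : m • ∑ a, u a = n • ∑ b, u' b := by
  classical
  have h₁ : ∀ a, ∑ b, (if R a b then u a else 0) = m • u a := fun a => by
    rw [← Finset.sum_filter, Finset.sum_const, ← Fintype.card_subtype, ← hm a,
      Nat.card_eq_fintype_card]
  have h₂ : ∀ b, ∑ a, (if R a b then u a else 0) = n • u' b := fun b => by
    rw [← hn b, Nat.card_eq_fintype_card, Fintype.card_subtype, ← Finset.sum_const,
      Finset.sum_filter]
    refine Finset.sum_congr rfl fun a _ => ?_
    split_ifs with h
    · exact hu a b h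
    · rfl
  rw [Finset.smul_sum, Finset.smul_sum, ← Finset.sum_congr rfl fun a _ => h₁ a, Finset.sum_comm]
  exact Finset.sum_congr rfl fun b _ => h₂ b

/-! ### Complexes of homogeneous maps -/

section HomComplex

variable {X V X' V' : FlagSpace.{v} k}

/-- The differential `a ↦ d_V a - (-1)ⁿ a d_X` of the complex `Hom^•(X, V)` in degree `n`. It is
defined on all linear maps; only its values on `gradedHom X V n` are meaningful. -/
def homDiff (dX : Differential X) (dV : Differential V) (n : ℤ) :
    (X →ₗ[k] V) →ₗ[k] (X →ₗ[k] V) where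
  toFun a := dV.toHom ∘ₗ a - (-1 : k) ^ n • (a ∘ₗ dX.toHom)
  map_add' a b := LinearMap.ext fun x => by
    simp only [LinearMap.sub_apply, LinearMap.smul_apply, LinearMap.comp_apply,
      LinearMap.add_apply, map_add, smul_add]
    abel
  map_smul' c a := LinearMap.ext fun x => by
    simp only [LinearMap.sub_apply, LinearMap.smul_apply, LinearMap.comp_apply, map_smul,
      smul_sub, smul_comm c, RingHom.id_apply]

theorem homDiff_apply (dX : Differential X) (dV : Differential V) (n : ℤ) (a : X →ₗ[k] V) (x : X) :
    homDiff dX dV n a x = dV (a x) - (-1 : k) ^ n • a (dX x) := rfl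

/-- The cocycles of degree `n` of `Hom^•(X, V)`. -/
def cocycles (dX : Differential X) (dV : Differential V) (n : ℤ) : Submodule k (X →ₗ[k] V) :=
  gradedHom X V n ⊓ LinearMap.ker (homDiff dX dV n)

/-- The coboundaries of degree `n` of `Hom^•(X, V)`. -/
def coboundaries (dX : Differential X) (dV : Differential V) (n : ℤ) : Submodule k (X →ₗ[k] V) :=
  (gradedHom X V (n - 1)).map (homDiff dX dV (n - 1))

variable {dX : Differential X} {dV : Differential V} {dX' : Differential X'}
  {dV' : Differential V'}

theorem mem_cocycles {n : ℤ} {a : X →ₗ[k] V} :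
    a ∈ cocycles dX dV n ↔ a ∈ gradedHom X V n ∧ homDiff dX dV n a = 0 := Iff.rfl

theorem mem_coboundaries_zero {a : X →ₗ[k] V} : a ∈ coboundaries dX dV 0 ↔
    ∃ c ∈ gradedHom X V (-1), ∀ x, a x = dV (c x) + c (dX x) := by
  refine exists_congr fun c => and_congr Iff.rfl ?_
  rw [eq_comm, LinearMap.ext_iff]
  refine forall_congr' fun x => ?_
  rw [homDiff_apply, zero_sub, zpow_neg_one, inv_neg, inv_one, neg_smul, one_smul, sub_neg_eq_add]

theorem mem_coboundaries_succ {n : ℤ} {a : X →ₗ[k] V} : a ∈ coboundaries dX dV (n + 1) ↔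
    ∃ c ∈ gradedHom X V n, homDiff dX dV n c = a := by
  rw [coboundaries, add_sub_cancel_right]; rfl

theorem homDiff_mem {n : ℤ} {a : X →ₗ[k] V} (ha : a ∈ gradedHom X V n) :
    homDiff dX dV n a ∈ gradedHom X V (n + 1) :=
  sub_mem (gradedHom_comp ha dV.mem.1 rfl)
    (Submodule.smul_mem _ _ (gradedHom_comp dX.mem.1 ha (add_comm 1 n)))

theorem homDiff_homDiff (n : ℤ) (a : X →ₗ[k] V) :
    homDiff dX dV (n + 1) (homDiff dX dV n a) = 0 := by
  ext x
  simp only [homDiff_apply, map_sub, map_smul, dV.sq, dX.sq, map_zero, smul_zero, sub_zero,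
    LinearMap.zero_apply]
  rw [zpow_add₀ (by simp), zpow_one, mul_neg_one, neg_smul]
  simp

theorem coboundaries_le_cocycles (n : ℤ) : coboundaries dX dV n ≤ cocycles dX dV n := by
  rintro _ ⟨c, hc, rfl⟩
  refine mem_cocycles.2 ⟨?_, ?_⟩
  · have := homDiff_mem (dX := dX) (dV := dV) hc
    rwa [sub_add_cancel] at this
  · have := homDiff_homDiff (dX := dX) (dV := dV) (n - 1) c
    rwa [sub_add_cancel] at this

/-- A linear map which is a quasi-isomorphism `Hom^•(X, V) → Hom^•(X', V')`: it preserves degrees,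
commutes with the differentials, and is injective and surjective on cohomology. -/
structure IsHomQuasiIso (dX : Differential X) (dV : Differential V) (dX' : Differential X')
    (dV' : Differential V') (F : (X →ₗ[k] V) →ₗ[k] (X' →ₗ[k] V')) : Prop where
  degree : ∀ n, ∀ a ∈ gradedHom X V n, F a ∈ gradedHom X' V' n
  comm : ∀ n a, homDiff dX' dV' n (F a) = F (homDiff dX dV n a)
  inj : ∀ n, ∀ a ∈ cocycles dX dV n, F a ∈ coboundaries dX' dV' n → a ∈ coboundaries dX dV n
  surj : ∀ n, ∀ z ∈ cocycles dX' dV' n, ∃ a ∈ cocycles dX dV n, F a - z ∈ coboundaries dX' dV' n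

theorem homDiff_comp_left {e : V →ₗ[k] V'} (he : ∀ x, e (dV x) = dV' (e x)) (n : ℤ)
    (a : X →ₗ[k] V) : homDiff dX dV' n (e ∘ₗ a) = e ∘ₗ homDiff dX dV n a := by
  ext x
  simp only [homDiff_apply, LinearMap.comp_apply, map_sub, map_smul, he]

theorem homDiff_comp_right {e : X' →ₗ[k] X} (he : ∀ x, e (dX' x) = dX (e x)) (n : ℤ)
    (a : X →ₗ[k] V) : homDiff dX' dV n (a ∘ₗ e) = homDiff dX dV n a ∘ₗ e := by
  ext x
  simp only [homDiff_apply, LinearMap.comp_apply, he]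

/-- Composition with a map homotopic to the identity is the identity on cohomology. -/
theorem comp_sub_mem_coboundaries {f : V →ₗ[k] V} (H : Homotopic dV dV f LinearMap.id) {n : ℤ}
    {a : X →ₗ[k] V} (ha : a ∈ cocycles dX dV n) : f ∘ₗ a - a ∈ coboundaries dX dV n := by
  obtain ⟨h, hh, H⟩ := H
  obtain ⟨ha, hda⟩ := mem_cocycles.1 ha
  refine ⟨h ∘ₗ a, gradedHom_comp ha hh (by ring), LinearMap.ext fun x => ?_⟩
  have h1 := LinearMap.congr_fun hda x
  rw [homDiff_apply, LinearMap.zero_apply, sub_eq_zero] at h1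
  have h2 := H (a x)
  rw [LinearMap.id_apply, h1, map_smul] at h2
  rw [homDiff_apply, zpow_sub₀ (by simp), zpow_one]
  simp only [LinearMap.sub_apply, LinearMap.comp_apply, h2, div_neg, div_one, neg_smul,
    sub_neg_eq_add]

/-- Precomposition with a map homotopic to the identity is the identity on cohomology. The sign in
the differential makes `(-1)ⁿ a h` the element bounding `a f - a`. -/
theorem comp_right_sub_mem_coboundaries {f : X →ₗ[k] X} (H : Homotopic dX dX f LinearMap.id)
    {n : ℤ} {a : X →ₗ[k] V} (ha : a ∈ cocycles dX dV n) : a ∘ₗ f - a ∈ coboundaries dX dV n := by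
  obtain ⟨h, hh, H⟩ := H
  obtain ⟨ha, hda⟩ := mem_cocycles.1 ha
  have hs : ((-1 : k) ^ n) * (-1) ^ n = 1 := by
    rw [← mul_zpow]; simp
  refine ⟨(-1 : k) ^ n • (a ∘ₗ h), Submodule.smul_mem _ _ (gradedHom_comp hh ha (by ring)),
    LinearMap.ext fun x => ?_⟩
  have h1 := LinearMap.congr_fun hda (h x)
  rw [homDiff_apply, LinearMap.zero_apply, sub_eq_zero] at h1
  have h2 := congrArg a (H x)
  rw [LinearMap.id_apply, map_sub, map_add] at h2
  rw [homDiff_apply, zpow_sub₀ (by simp), zpow_one, LinearMap.sub_apply, LinearMap.comp_apply, h2]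
  simp only [LinearMap.smul_apply, LinearMap.comp_apply, map_smul, h1, smul_smul, hs, one_smul,
    div_neg, div_one, neg_mul, neg_smul, sub_neg_eq_add]

theorem Triple.isHomQuasiIso_comp_left (dX : Differential X) (t : Triple V V') :
    IsHomQuasiIso dX t.dSource dX t.dTarget (LinearMap.compRight k t.map) := by
  obtain ⟨-, -, H, H'⟩ := t.isDual_dual
  have hc := homDiff_comp_left (dX := dX) t.comm
  have hc' := homDiff_comp_left (dX := dX) t.dual.comm
  refine ⟨fun n a ha => gradedHom_comp ha t.degree (add_zero n), hc, ?_, fun n z hz => ?_⟩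
  · rintro n a ha ⟨c, hc₁, hc₂⟩
    have h1 := comp_sub_mem_coboundaries H ha
    refine (Submodule.sub_mem_iff_right _ (x := (t.dual.map ∘ₗ t.map) ∘ₗ a) ?_).1 h1
    refine ⟨t.dual.map ∘ₗ c, gradedHom_comp hc₁ t.dual.degree (add_zero _), ?_⟩
    exact (hc' (n - 1) c).trans (congrArg (t.dual.map ∘ₗ ·) hc₂)
  · obtain ⟨hz₁, hz₂⟩ := mem_cocycles.1 hz
    refine ⟨t.dual.map ∘ₗ z, mem_cocycles.2 ⟨gradedHom_comp hz₁ t.dual.degree (add_zero n),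
      (hc' n z).trans ?_⟩, comp_sub_mem_coboundaries H' hz⟩
    exact (congrArg (t.dual.map ∘ₗ ·) hz₂).trans (LinearMap.comp_zero _)

theorem Triple.isHomQuasiIso_comp_right (t : Triple X X') (dV : Differential V) :
    IsHomQuasiIso t.dTarget dV t.dSource dV (LinearMap.lcomp k V t.map) := by
  obtain ⟨-, -, H, H'⟩ := t.isDual_dual
  have hc := homDiff_comp_right (dV := dV) t.comm
  have hc' := homDiff_comp_right (dV := dV) t.dual.comm
  refine ⟨fun n a ha => gradedHom_comp t.degree ha (zero_add n), hc, ?_, fun n z hz => ?_⟩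
  · rintro n a ha ⟨c, hc₁, hc₂⟩
    have h1 := comp_right_sub_mem_coboundaries H' ha
    refine (Submodule.sub_mem_iff_right _ (x := a ∘ₗ (t.map ∘ₗ t.dual.map)) ?_).1 h1
    refine ⟨c ∘ₗ t.dual.map, gradedHom_comp t.dual.degree hc₁ (zero_add _), ?_⟩
    exact (hc' (n - 1) c).trans (congrArg (· ∘ₗ t.dual.map) hc₂)
  · obtain ⟨hz₁, hz₂⟩ := mem_cocycles.1 hz
    refine ⟨z ∘ₗ t.dual.map, mem_cocycles.2 ⟨gradedHom_comp t.dual.degree hz₁ (zero_add n),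
      (hc' n z).trans ?_⟩, comp_right_sub_mem_coboundaries H hz⟩
    exact (congrArg (· ∘ₗ t.dual.map) hz₂).trans (LinearMap.zero_comp _)

namespace IsHomQuasiIso

variable {F : (X →ₗ[k] V) →ₗ[k] (X' →ₗ[k] V')} (hF : IsHomQuasiIso dX dV dX' dV' F)
include hF

theorem map_coboundaries {n : ℤ} {a : X →ₗ[k] V} (ha : a ∈ coboundaries dX dV n) :
    F a ∈ coboundaries dX' dV' n := by
  obtain ⟨c, hc, rfl⟩ := ha
  exact ⟨F c, hF.degree _ _ hc, hF.comm _ _⟩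

/-- Lifting along a quasi-isomorphism `F` of complexes of homogeneous maps: if `F w = ∂ z`, then
the solutions `a` of `∂ a = w` with `F a` cohomologous to `z` form a torsor under the
coboundaries. -/
theorem card_lifts {n : ℤ} {w : X →ₗ[k] V} {z : X' →ₗ[k] V'} (hw : w ∈ cocycles dX dV (n + 1))
    (hz : z ∈ gradedHom X' V' n) (hwz : F w = homDiff dX' dV' n z) :
    Nat.card {a // a ∈ gradedHom X V n ∧ homDiff dX dV n a = w ∧
      F a - z ∈ coboundaries dX' dV' n} = Nat.card (coboundaries dX dV n) := by
  obtain ⟨b, hb, hbw⟩ := mem_coboundaries_succ.1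
    (hF.inj _ w hw (mem_coboundaries_succ.2 ⟨z, hz, hwz.symm⟩))
  obtain ⟨y, hy, hyz⟩ := hF.surj n (F b - z) (mem_cocycles.2
    ⟨sub_mem (hF.degree _ _ hb) hz, by rw [map_sub, hF.comm, hbw, hwz, sub_self]⟩)
  obtain ⟨hy₁, hy₂⟩ := mem_cocycles.1 hy
  have h₁ : homDiff dX dV n (b - y) = w := by rw [map_sub, hbw, hy₂, sub_zero]
  have h₂ : F (b - y) - z ∈ coboundaries dX' dV' n := by
    have h := neg_mem hyz
    rwa [neg_sub, sub_sub, add_comm z, ← sub_sub, ← map_sub] at h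
  refine Nat.card_congr
    { toFun := fun a => ⟨a.1 - (b - y), hF.inj n _ (mem_cocycles.2
        ⟨sub_mem a.2.1 (sub_mem hb hy₁), by rw [map_sub, a.2.2.1, h₁, sub_self]⟩) ?_⟩
      invFun := fun c => ⟨c.1 + (b - y), ?_, ?_, ?_⟩
      left_inv := fun a => Subtype.ext (sub_add_cancel _ _)
      right_inv := fun c => Subtype.ext (add_sub_cancel_right _ _) }
  · have h := sub_mem a.2.2.2 h₂
    rwa [sub_sub_sub_cancel_right, ← map_sub] at h
  · exact add_mem (mem_cocycles.1 (coboundaries_le_cocycles n c.2)).1 (sub_mem hb hy₁)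
  · rw [map_add, h₁, (mem_cocycles.1 (coboundaries_le_cocycles n c.2)).2, zero_add]
  · rw [map_add, add_sub_assoc]
    exact add_mem (hF.map_coboundaries c.2) h₂

/-- Quasi-isomorphic complexes have cohomology of the same size. -/
theorem card_cocycles_mul [Finite k] (n : ℤ) :
    Nat.card (cocycles dX dV n) * Nat.card (coboundaries dX' dV' n) =
      Nat.card (cocycles dX' dV' n) * Nat.card (coboundaries dX dV n) := by
  have := Fintype.ofFinite (cocycles dX dV n)
  have := Fintype.ofFinite (cocycles dX' dV' n)
  have h := smul_sum_eq_smul_sum_of_card_eq (M := ℚ)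
    (R := fun (a : cocycles dX dV n) (z : cocycles dX' dV' n) =>
      F a.1 - z.1 ∈ coboundaries dX' dV' n) (u := fun _ => 1) (u' := fun _ => 1)
    (m := Nat.card (coboundaries dX' dV' n)) (n := Nat.card (coboundaries dX dV n))
    (fun a => Nat.card_congr
      { toFun := fun z => ⟨_, z.2⟩
        invFun := fun c => ⟨⟨F a.1 - c.1, sub_mem (mem_cocycles.2 ⟨hF.degree _ _ a.2.1, by
          rw [hF.comm, (mem_cocycles.1 a.2).2, map_zero]⟩) (coboundaries_le_cocycles n c.2)⟩, by
          rw [sub_sub_cancel]; exact c.2⟩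
        left_inv := fun z => Subtype.ext (Subtype.ext (sub_sub_cancel _ _))
        right_inv := fun c => Subtype.ext (sub_sub_cancel _ _) })
    (fun z => (Nat.card_congr
      { toFun := fun a => ⟨a.1.1, a.1.2.1, a.1.2.2, a.2⟩
        invFun := fun a => ⟨⟨a.1, a.2.1, a.2.2.1⟩, a.2.2.2⟩
        left_inv := fun _ => rfl
        right_inv := fun _ => rfl }).trans (hF.card_lifts (w := 0) (zero_mem _)
          (mem_cocycles.1 z.2).1 (by rw [map_zero, (mem_cocycles.1 z.2).2])))
    (fun _ _ _ => rfl)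
  simp only [Finset.sum_const, Finset.card_univ, nsmul_eq_mul, mul_one,
    Fintype.card_eq_nat_card] at h
  rw [mul_comm, mul_comm (Nat.card (cocycles dX' dV' n))]
  exact_mod_cast h

end IsHomQuasiIso

theorem card_gradedHom_eq (dX : Differential X) (dV : Differential V) (n : ℤ) :
    Nat.card (gradedHom X V n) =
      Nat.card (cocycles dX dV n) * Nat.card (coboundaries dX dV (n + 1)) := by
  have h := ((homDiff dX dV n).domRestrict (gradedHom X V n)).finrank_range_add_finrank_ker
  have h₁ : LinearMap.range ((homDiff dX dV n).domRestrict (gradedHom X V n)) =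
      coboundaries dX dV (n + 1) := by
    ext a
    rw [mem_coboundaries_succ]
    exact ⟨fun ⟨c, hc⟩ => ⟨c.1, c.2, hc⟩, fun ⟨c, hc, e⟩ => ⟨⟨c, hc⟩, e⟩⟩
  have e : LinearMap.ker ((homDiff dX dV n).domRestrict (gradedHom X V n)) ≃ₗ[k]
      cocycles dX dV n :=
    { toFun := fun a => ⟨a.1.1, a.1.2, a.2⟩
      invFun := fun a => ⟨⟨a.1, a.2.1⟩, a.2.2⟩
      map_add' := fun _ _ => rfl
      map_smul' := fun _ _ => rfl
      left_inv := fun _ => rfl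
      right_inv := fun _ => rfl }
  rw [h₁, e.finrank_eq] at h
  rw [Module.natCard_eq_pow_finrank (K := k), Module.natCard_eq_pow_finrank (K := k)
    (V := cocycles dX dV n), Module.natCard_eq_pow_finrank (K := k)
    (V := coboundaries dX dV (n + 1)), ← pow_add, ← h, add_comm]

/-- Homogeneous maps of sufficiently negative degree vanish. -/
theorem exists_gradedHom_eq_bot (X V : FlagSpace.{v} k) :
    ∃ N : ℕ, ∀ n : ℤ, n ≤ -N → gradedHom X V n = ⊥ := by
  have hX := (WellFoundedGT.finite_ne_bot_of_iSupIndep X.isInternal.submodule_iSupIndep)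
  have hV := (WellFoundedGT.finite_ne_bot_of_iSupIndep V.isInternal.submodule_iSupIndep)
  obtain ⟨b, hb⟩ := hX.bddAbove
  obtain ⟨c, hc⟩ := hV.bddBelow
  refine ⟨(b - c + 1).toNat, fun n hn => ?_⟩
  refine (Submodule.eq_bot_iff _).2 fun f hf =>
    linearMap_ext_of_isInternal X.isInternal fun i x hx => ?_
  by_contra hfx
  have hi : i ≤ b := hb fun h : X.grading i = ⊥ => hfx (by
    rw [h, Submodule.mem_bot] at hx
    rw [hx, map_zero, map_zero])
  have hj : c ≤ i + n := hc fun h : V.grading (i + n) = ⊥ => hfx (by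
    have := hf i x hx
    rwa [h, Submodule.mem_bot] at this)
  omega

end HomComplex

/-! ### The normalization of the monoidal product -/

/-- Telescoping of an alternating product. -/
theorem prod_zpow_mul_eq {r q : ℕ → ℚ} (hr : ∀ i, r i ≠ 0) (h : ∀ i, r i * r (i + 1) = q i)
    (N : ℕ) : (∏ i ∈ Finset.range N, q i ^ ((-1 : ℤ) ^ (i + 1))) * r 0 =
      r N ^ ((-1 : ℤ) ^ N) := by
  induction N with
  | zero => simp
  | succ N ih =>
    rw [Finset.prod_range_succ, mul_right_comm, ih, ← h, mul_zpow, pow_succ, mul_neg_one, zpow_neg,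
      ← mul_assoc, mul_inv_cancel₀ (zpow_ne_zero _ (hr N)), one_mul]

/-- The infinite product defining the factor has only finitely many factors different from `1`,
because homogeneous maps of very negative degree vanish. -/
theorem tensorFactor_eq_prod (U V X Y : FlagSpace.{v} k) :
    ∃ N₀ : ℕ, ∀ N ≥ N₀, tensorFactor U V X Y = ∏ i ∈ Finset.range N,
      ((Nat.card (gradedHom X U (-i)) : ℚ) * Nat.card (gradedHom Y V (-i)) *
        Nat.card (gradedHom X V (-i - 1))) ^ ((-1 : ℤ) ^ (i + 1)) := by
  obtain ⟨N₁, h₁⟩ := exists_gradedHom_eq_bot X U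
  obtain ⟨N₂, h₂⟩ := exists_gradedHom_eq_bot Y V
  obtain ⟨N₃, h₃⟩ := exists_gradedHom_eq_bot X V
  refine ⟨max N₁ (max N₂ N₃), fun N hN => finprod_eq_prod_of_mulSupport_subset _ fun i hi => ?_⟩
  by_contra hiN
  rw [Finset.mem_coe, Finset.mem_range] at hiN
  refine hi ?_
  dsimp only
  rw [h₁ _ (by omega), h₂ _ (by omega), h₃ _ (by omega)]
  simp

/-- Counting cochains as `|Cⁿ| = |Zⁿ| |Bⁿ⁺¹|` turns the product of the factors `|Hom^{-i-1}(X, V)|`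
and `|B⁰(X, V)|` into the alternating product of the sizes of the cohomology groups of
`Hom^•(X, V)` in negative degrees, which agree with those of `Hom^•(Y, U)`. -/
theorem tensorFactor_mul_card_coboundaries [Finite k] {U V X Y : FlagSpace.{v} k}
    (t : Triple U V) (s : Triple X Y) :
    tensorFactor U V X Y * Nat.card (coboundaries s.dSource t.dTarget 0) =
      tensorFactor V U Y X * Nat.card (coboundaries s.dTarget t.dSource 0) := by
  have pos : ∀ {A B : FlagSpace.{v} k} (S : Submodule k (A →ₗ[k] B)), (Nat.card S : ℚ) ≠ 0 :=
    fun S => Nat.cast_ne_zero.2 Nat.card_pos.ne'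
  obtain ⟨N₁, h₁⟩ := tensorFactor_eq_prod U V X Y
  obtain ⟨N₂, h₂⟩ := tensorFactor_eq_prod V U Y X
  obtain ⟨N₃, h₃⟩ := exists_gradedHom_eq_bot X V
  obtain ⟨N₄, h₄⟩ := exists_gradedHom_eq_bot Y U
  let N := max (max N₁ N₂) (max N₃ N₄)
  have hN₁ : N₁ ≤ N := by omega
  have hN₂ : N₂ ≤ N := by omega
  have hN₃ : N₃ ≤ N := by omega
  have hN₄ : N₄ ≤ N := by omega
  let b : ℤ → ℚ := fun n => Nat.card (coboundaries s.dSource t.dTarget n)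
  let b' : ℤ → ℚ := fun n => Nat.card (coboundaries s.dTarget t.dSource n)
  let c : ℕ → ℚ := fun i => Nat.card (gradedHom X V (-i - 1))
  let c' : ℕ → ℚ := fun i => Nat.card (gradedHom Y U (-i - 1))
  have hb : ∀ n, b n ≠ 0 := fun n => pos _
  have hb' : ∀ n, b' n ≠ 0 := fun n => pos _
  have hc' : ∀ i, c' i ≠ 0 := fun i => pos _
  -- The quotients `b n / b' n` of the numbers of coboundaries in degrees `-i` and `-i - 1` multiply
  -- to the quotient of the numbers of cochains in degree `-i - 1`.
  have key : ∀ i : ℕ, b (-i) / b' (-i) * (b (-(i + 1 : ℕ)) / b' (-(i + 1 : ℕ))) = c i / c' i := by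
    intro i
    have e : (-(i + 1 : ℕ) : ℤ) = -i - 1 := by push_cast; ring
    have a₁ := card_gradedHom_eq s.dSource t.dTarget (-i - 1)
    have a₂ := card_gradedHom_eq s.dTarget t.dSource (-i - 1)
    rw [sub_add_cancel] at a₁ a₂
    -- `Hom^•(X, V)` and `Hom^•(Y, U)` are compared through `Hom^•(X, U)`.
    have a₃ : Nat.card (cocycles s.dSource t.dTarget (-i - 1)) *
        Nat.card (coboundaries s.dSource t.dSource (-i - 1)) =
        Nat.card (cocycles s.dSource t.dSource (-i - 1)) *
          Nat.card (coboundaries s.dSource t.dTarget (-i - 1)) :=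
      (t.dual.isHomQuasiIso_comp_left s.dSource).card_cocycles_mul (-i - 1)
    have a₄ := (s.isHomQuasiIso_comp_right t.dSource).card_cocycles_mul (-i - 1)
    have q₁ := pos (coboundaries s.dSource t.dSource (-i - 1))
    have q₂ := pos (cocycles s.dSource t.dSource (-i - 1))
    have q₃ := pos (cocycles s.dTarget t.dSource (-i - 1))
    have d₁ := hb (-i)
    have d₂ := hb' (-i)
    have d₃ := hb' (-i - 1)
    have d₄ := hc' i
    rw [e]
    simp only [b, b', c, c'] at d₁ d₂ d₃ d₄ ⊢
    rw [a₂] at d₄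
    rw [a₁, a₂]
    replace a₃ := congrArg (Nat.cast : ℕ → ℚ) a₃
    replace a₄ := congrArg (Nat.cast : ℕ → ℚ) a₄
    push_cast at a₃ a₄ ⊢
    rw [div_mul_div_comm, mul_div_mul_comm, mul_comm (Nat.card (cocycles _ _ _) : ℚ),
      mul_comm (Nat.card (cocycles _ _ _) : ℚ), mul_div_mul_comm]
    congr 1
    rw [div_eq_div_iff d₃ q₃]
    refine mul_left_cancel₀ (mul_ne_zero q₁ q₂) ?_
    linear_combination
      (-Nat.card (coboundaries s.dTarget t.dSource (-i - 1)) *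
        Nat.card (cocycles s.dSource t.dSource (-i - 1)) : ℚ) * a₃ +
      (Nat.card (cocycles s.dSource t.dSource (-i - 1)) *
        Nat.card (coboundaries s.dSource t.dTarget (-i - 1)) : ℚ) * a₄
  have main := prod_zpow_mul_eq (r := fun i => b (-i) / b' (-i)) (q := fun i => c i / c' i)
    (fun i => div_ne_zero (hb _) (hb' _)) key N
  have hbN : b (-N) = 1 := by
    simp only [b]
    rw [coboundaries, h₃ _ (by omega), Submodule.map_bot]
    simp
  have hbN' : b' (-N) = 1 := by
    simp only [b']
    rw [coboundaries, h₄ _ (by omega), Submodule.map_bot]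
    simp
  simp only [hbN, hbN', div_one, one_zpow, Nat.cast_zero, neg_zero] at main
  have hT : tensorFactor U V X Y = tensorFactor V U Y X *
      ∏ i ∈ Finset.range N, (c i / c' i) ^ ((-1 : ℤ) ^ (i + 1)) := by
    rw [h₁ N hN₁, h₂ N hN₂, ← Finset.prod_mul_distrib]
    refine Finset.prod_congr rfl fun i _ => ?_
    rw [← mul_zpow]
    congr 1
    have := hc' i
    simp only [c, c'] at this ⊢
    field_simp
  rw [hT]
  rw [mul_div_assoc', div_eq_one_iff_eq (hb' 0)] at main
  rw [mul_assoc]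
  exact congrArg _ main

/-! ### Duality and the monoidal product -/

section Tensor

variable {U V X Y : FlagSpace.{v} k} {t : Triple U V} {s : Triple X Y}

/-- Data `δ` for `(f, g)` and `δ'` for the homotopy inverses `(f', g')` are related if they have
the same extension classes `δ₁₁`, `δ₂₂`, up to the exchange of source and target, and if the
matrix `[[f', δ'₁₂], [0, g']]` is a left homotopy inverse of `[[f, δ₁₂], [0, g]]` through a
homotopy of the form `[[h₁, *], [0, h₂]]`. -/
def ExtensionDatum.Related (h₁ : U →ₗ[k] U) (h₂ : X →ₗ[k] X) (δ : ExtensionDatum t s)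
    (δ' : ExtensionDatum t.dual s.dual) : Prop :=
  δ'.δ₁₁ = δ.δ₂₂ ∧ δ'.δ₂₂ = δ.δ₁₁ ∧
    t.dual.map ∘ₗ δ.δ₁₂ + δ'.δ₁₂ ∘ₗ s.map - (h₁ ∘ₗ δ.δ₁₁ + δ.δ₁₁ ∘ₗ h₂) ∈
      coboundaries s.dSource t.dSource 0

variable {h₁ : U →ₗ[k] U} {h₂ : X →ₗ[k] X}

/-- The off-diagonal entry of the homotopy is supplied by the coboundary condition in
`ExtensionDatum.Related`. -/
theorem ExtensionDatum.Related.isDual {δ : ExtensionDatum t s}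
    {δ' : ExtensionDatum t.dual s.dual} (m₁ : h₁ ∈ gradedHom U U (-1))
    (H₁ : ∀ x, t.dual.map (t.map x) - x = t.dSource (h₁ x) + h₁ (t.dSource x))
    (m₂ : h₂ ∈ gradedHom X X (-1))
    (H₂ : ∀ x, s.dual.map (s.map x) - x = s.dSource (h₂ x) + h₂ (s.dSource x))
    (h : δ.Related h₁ h₂ δ') : δ.triple.IsDual δ'.triple := by
  obtain ⟨e₁, e₂, h⟩ := h
  obtain ⟨c, hc, hcx⟩ := mem_coboundaries_zero.1 h
  refine Triple.isDual_of_left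
    (Differential.ext (congrArg (blockMap t.dTarget.toHom · s.dTarget.toHom) e₁))
    (Differential.ext (congrArg (blockMap t.dSource.toHom · s.dSource.toHom) e₂))
    ⟨blockMap h₁ c h₂, blockMap_mem m₁ hc m₂, ?_⟩
  rintro ⟨u, x⟩
  refine Prod.ext ?_ (H₂ x)
  change t.dual.map (t.map u + δ.δ₁₂ x) + δ'.δ₁₂ (s.map x) - u =
    t.dSource (h₁ u + c x) + δ.δ₁₁ (h₂ x) + (h₁ (t.dSource u + δ.δ₁₁ x) + c (s.dSource x))
  have a₁ := hcx x
  have a₂ := H₁ u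
  simp only [LinearMap.sub_apply, LinearMap.add_apply, LinearMap.comp_apply, map_add] at a₁ ⊢
  linear_combination (norm := abel) a₁ + a₂

theorem add_sub_mem_iff {M : Type*} [AddCommGroup M] [Module k M] (B : Submodule k M)
    (p q r : M) : p + q - r ∈ B ↔ q - (r - p) ∈ B := by
  rw [sub_sub_eq_add_sub, add_comm]

theorem homDiff_zero_apply {d : Differential X} {d' : Differential V} (a : X →ₗ[k] V) (x : X) :
    homDiff d d' 0 a x = d' (a x) - a (d x) := by
  rw [homDiff_apply, zpow_zero, one_smul]

theorem mem_cocycles_one {d : Differential X} {d' : Differential V} {a : X →ₗ[k] V}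
    (ha : a ∈ gradedHom X V 1) (h : ∀ x, d' (a x) + a (d x) = 0) : a ∈ cocycles d d' (0 + 1) := by
  refine mem_cocycles.2 ⟨ha, LinearMap.ext fun x => ?_⟩
  rw [homDiff_apply, zero_add, zpow_one, neg_smul, one_smul, sub_neg_eq_add, h]; rfl

/-- The element `h₁ δ + δ h₂` is a homotopy from `δ g' g` to `f' f δ`. -/
theorem homDiff_homotopy {δ : X →ₗ[k] U}
    (hδ : ∀ x, t.dSource (δ x) + δ (s.dSource x) = 0)
    (H₁ : ∀ x, t.dual.map (t.map x) - x = t.dSource (h₁ x) + h₁ (t.dSource x))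
    (H₂ : ∀ x, s.dual.map (s.map x) - x = s.dSource (h₂ x) + h₂ (s.dSource x)) (x : X) :
    homDiff s.dSource t.dSource 0 (h₁ ∘ₗ δ + δ ∘ₗ h₂) x =
      t.dual.map (t.map (δ x)) - δ (s.dual.map (s.map x)) := by
  have a₁ := H₁ (δ x)
  have a₂ := congrArg δ (H₂ x)
  have a₃ := congrArg h₁ (hδ x)
  have a₄ := hδ (h₂ x)
  rw [homDiff_zero_apply]
  simp only [LinearMap.add_apply, LinearMap.comp_apply, map_add, map_sub, map_zero] at a₂ a₃ ⊢
  linear_combination (norm := abel) a₂ - a₁ - a₃ + a₄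

/-- The entries `δ'₁₂` for given `δ` are the lifts of `h₁ δ₁₁ + δ₁₁ h₂ - f' δ₁₂` along composition
with `g` from `Hom^•(Y, U)` to `Hom^•(X, U)`. -/
theorem ExtensionDatum.card_related_right [Finite k] (m₁ : h₁ ∈ gradedHom U U (-1))
    (H₁ : ∀ x, t.dual.map (t.map x) - x = t.dSource (h₁ x) + h₁ (t.dSource x))
    (m₂ : h₂ ∈ gradedHom X X (-1))
    (H₂ : ∀ x, s.dual.map (s.map x) - x = s.dSource (h₂ x) + h₂ (s.dSource x))
    (δ : ExtensionDatum t s) : Nat.card {δ' : ExtensionDatum t.dual s.dual // δ.Related h₁ h₂ δ'} =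
      Nat.card (coboundaries s.dTarget t.dSource 0) := by
  have c' : ∀ y, s.dual.map (s.dTarget y) = s.dSource (s.dual.map y) := s.dual.comm
  have c : ∀ y, t.dual.map (t.dTarget y) = t.dSource (t.dual.map y) := t.dual.comm
  have key := (s.isHomQuasiIso_comp_right t.dSource).card_lifts (n := 0)
    (w := t.dual.map ∘ₗ δ.δ₂₂ - δ.δ₁₁ ∘ₗ s.dual.map)
    (z := h₁ ∘ₗ δ.δ₁₁ + δ.δ₁₁ ∘ₗ h₂ - t.dual.map ∘ₗ δ.δ₁₂)
    (mem_cocycles_one (sub_mem (gradedHom_comp δ.mem₂₂ t.dual.degree rfl)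
      (gradedHom_comp s.dual.degree δ.mem₁₁ rfl)) fun y => by
        have a₁ := congrArg t.dual.map (δ.eq₂₂ y)
        have a₂ := δ.eq₁₁ (s.dual.map y)
        rw [map_add, map_zero, c] at a₁
        simp only [LinearMap.sub_apply, LinearMap.comp_apply, map_sub]
        rw [c']
        linear_combination (norm := abel) a₁ - a₂)
    (sub_mem (add_mem (gradedHom_comp δ.mem₁₁ m₁ rfl) (gradedHom_comp m₂ δ.mem₁₁ rfl))
      (gradedHom_comp δ.mem₁₂ t.dual.degree rfl))
    (LinearMap.ext fun x => by
      rw [map_sub (homDiff _ _ _), LinearMap.sub_apply, homDiff_homotopy δ.eq₁₁ H₁ H₂, homDiff_zero_apply]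
      have a := congrArg t.dual.map (δ.eq₁₂ x)
      simp only [map_add, c] at a
      simp only [LinearMap.lcomp_apply, LinearMap.sub_apply, LinearMap.comp_apply]
      linear_combination (norm := abel) -a)
  rw [← key]
  refine Nat.card_congr
    { toFun := fun δ' => ⟨δ'.1.δ₁₂, δ'.1.mem₁₂, ?_, ?_⟩
      invFun := fun a => ⟨⟨δ.δ₂₂, a.1, δ.δ₁₁, δ.mem₂₂, a.2.1, δ.mem₁₁, δ.eq₂₂, δ.eq₁₁, ?_⟩,
        rfl, rfl, ?_⟩
      left_inv := fun δ' => Subtype.ext (ExtensionDatum.ext δ'.2.1.symm rfl δ'.2.2.1.symm)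
      right_inv := fun _ => rfl }
  · obtain ⟨δ', e₁, e₂, -⟩ := δ'
    refine LinearMap.ext fun y => ?_
    have a : δ'.δ₁₂ (s.dTarget y) + t.dual.map (δ'.δ₁₁ y) =
      t.dSource (δ'.δ₁₂ y) + δ'.δ₂₂ (s.dual.map y) := δ'.eq₁₂ y
    rw [e₁, e₂] at a
    rw [homDiff_zero_apply]
    simp only [LinearMap.sub_apply, LinearMap.comp_apply]
    linear_combination (norm := abel) -a
  · exact (add_sub_mem_iff _ _ _ _).1 δ'.2.2.2
  · intro y
    have h := LinearMap.congr_fun a.2.2.1 y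
    rw [homDiff_zero_apply] at h
    simp only [LinearMap.sub_apply, LinearMap.comp_apply] at h
    change a.1 (s.dTarget y) + t.dual.map (δ.δ₂₂ y) =
      t.dSource (a.1 y) + δ.δ₁₁ (s.dual.map y)
    linear_combination (norm := abel) -h
  · exact (add_sub_mem_iff _ _ _ _).2 a.2.2.2

/-- The entries `δ₁₂` for given `δ'` are the lifts of `h₁ δ₁₁ + δ₁₁ h₂ - δ'₁₂ g` along composition
with `f'` from `Hom^•(X, V)` to `Hom^•(X, U)`. -/
theorem ExtensionDatum.card_related_left [Finite k] (m₁ : h₁ ∈ gradedHom U U (-1))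
    (H₁ : ∀ x, t.dual.map (t.map x) - x = t.dSource (h₁ x) + h₁ (t.dSource x))
    (m₂ : h₂ ∈ gradedHom X X (-1))
    (H₂ : ∀ x, s.dual.map (s.map x) - x = s.dSource (h₂ x) + h₂ (s.dSource x))
    (δ' : ExtensionDatum t.dual s.dual) : Nat.card {δ : ExtensionDatum t s // δ.Related h₁ h₂ δ'} =
      Nat.card (coboundaries s.dSource t.dTarget 0) := by
  have e₁₁ : ∀ y, t.dTarget (δ'.δ₁₁ y) + δ'.δ₁₁ (s.dTarget y) = 0 := δ'.eq₁₁
  have e₂₂ : ∀ x, t.dSource (δ'.δ₂₂ x) + δ'.δ₂₂ (s.dSource x) = 0 := δ'.eq₂₂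
  have e₁₂ : ∀ y, δ'.δ₁₂ (s.dTarget y) + t.dual.map (δ'.δ₁₁ y) =
      t.dSource (δ'.δ₁₂ y) + δ'.δ₂₂ (s.dual.map y) := δ'.eq₁₂
  have hF : IsHomQuasiIso s.dSource t.dTarget s.dSource t.dSource
    (LinearMap.compRight k t.dual.map) := t.dual.isHomQuasiIso_comp_left s.dSource
  have key := hF.card_lifts (n := 0)
    (w := t.map ∘ₗ δ'.δ₂₂ - δ'.δ₁₁ ∘ₗ s.map)
    (z := h₁ ∘ₗ δ'.δ₂₂ + δ'.δ₂₂ ∘ₗ h₂ - δ'.δ₁₂ ∘ₗ s.map)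
    (mem_cocycles_one (sub_mem (gradedHom_comp δ'.mem₂₂ t.degree rfl)
      (gradedHom_comp s.degree δ'.mem₁₁ rfl)) fun x => by
        have a₁ := congrArg t.map (e₂₂ x)
        have a₂ := e₁₁ (s.map x)
        rw [map_add, map_zero, t.comm] at a₁
        simp only [LinearMap.sub_apply, LinearMap.comp_apply, map_sub]
        rw [s.comm]
        linear_combination (norm := abel) a₁ - a₂)
    (sub_mem (add_mem (gradedHom_comp δ'.mem₂₂ m₁ rfl) (gradedHom_comp m₂ δ'.mem₂₂ rfl))
      (gradedHom_comp s.degree δ'.mem₁₂ rfl))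
    (LinearMap.ext fun x => by
      rw [map_sub (homDiff _ _ _), LinearMap.sub_apply, homDiff_homotopy e₂₂ H₁ H₂, homDiff_zero_apply]
      have a := e₁₂ (s.map x)
      simp only [LinearMap.compRight_apply, LinearMap.sub_apply, LinearMap.comp_apply, map_sub]
      rw [s.comm]
      linear_combination (norm := abel) -a)
  rw [← key]
  refine Nat.card_congr
    { toFun := fun δ => ⟨δ.1.δ₁₂, δ.1.mem₁₂, ?_, ?_⟩
      invFun := fun a => ⟨⟨δ'.δ₂₂, a.1, δ'.δ₁₁, δ'.mem₂₂, a.2.1, δ'.mem₁₁, e₂₂, e₁₁, ?_⟩,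
        rfl, rfl, ?_⟩
      left_inv := fun δ => Subtype.ext (ExtensionDatum.ext δ.2.2.1 rfl δ.2.1)
      right_inv := fun _ => rfl }
  · obtain ⟨δ, e₁, e₂, -⟩ := δ
    refine LinearMap.ext fun x => ?_
    have a := δ.eq₁₂ x
    rw [← e₁, ← e₂] at a
    rw [homDiff_zero_apply]
    simp only [LinearMap.sub_apply, LinearMap.comp_apply]
    linear_combination (norm := abel) -a
  · have h := δ.2.2.2
    rw [← δ.2.2.1, add_comm] at h
    exact (add_sub_mem_iff _ _ _ _).1 h
  · intro x
    have h := LinearMap.congr_fun a.2.2.1 x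
    rw [homDiff_zero_apply] at h
    simp only [LinearMap.sub_apply, LinearMap.comp_apply] at h
    linear_combination (norm := abel) -h
  · have h := (add_sub_mem_iff _ _ _ _).2 a.2.2.2
    rw [add_comm] at h
    exact h

/-- Compatibility with the monoidal product on basis elements, by double counting of related
extension data. -/
theorem dualMap_tensor [Finite k] (t : Triple U V) (s : Triple X Y) :
    dualMap (tensorObj U X) (tensorObj V Y) (t.tensor s) = t.dual.tensor s.dual := by
  obtain ⟨-, -, ⟨h₁, m₁, H₁⟩, -⟩ := t.isDual_dual
  obtain ⟨-, -, ⟨h₂, m₂, H₂⟩, -⟩ := s.isDual_dual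
  have h := smul_sum_eq_smul_sum_of_card_eq
    (R := fun (δ : ExtensionDatum t s) (δ' : ExtensionDatum t.dual s.dual) => δ.Related h₁ h₂ δ')
    (u := fun δ => dualMap (tensorObj U X) (tensorObj V Y) δ.triple.basis)
    (u' := fun δ' => δ'.triple.basis)
    (ExtensionDatum.card_related_right m₁ H₁ m₂ H₂) (ExtensionDatum.card_related_left m₁ H₁ m₂ H₂)
    (fun δ δ' r => dualMap_basis (r.isDual m₁ H₁ m₂ H₂))
  have hF := tensorFactor_mul_card_coboundaries t s
  have hb : (Nat.card (coboundaries s.dTarget t.dSource 0) : ℚ) ≠ 0 :=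
    Nat.cast_ne_zero.2 Nat.card_pos.ne'
  rw [← Nat.cast_smul_eq_nsmul ℚ, ← Nat.cast_smul_eq_nsmul ℚ] at h
  unfold Triple.tensor
  rw [map_smul, map_sum]
  refine smul_right_injective _ hb ?_
  dsimp only
  rw [smul_comm, h, smul_smul, hF, mul_comm, mul_smul]

theorem dualHom_tensorMap [Finite k] (f : U ⟶ V) (g : X ⟶ Y) :
    dualHom (tensorObj U X) (tensorObj V Y) (tensorMap U V X Y f g) =
      tensorMap V U Y X (dualHom U V f) (dualHom X Y g) := by
  have hb : ∀ {U V X Y : FlagSpace.{v} k} (t : Triple U V) (s : Triple X Y),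
      tensorMap U V X Y t.hom s.hom = t.tensor s := fun t s => bilinearExtend_single _ _ _
  have hd : ∀ {U V : FlagSpace.{v} k} (t : Triple U V), dualHom U V t.hom = t.dual.hom :=
    fun t => dualMap_basis t.isDual_dual
  induction f using HomSpace.induction with
  | h0 =>
    change dualHom _ _ (tensorMap U V X Y 0 g) = tensorMap V U Y X (dualHom U V 0) _
    simp only [map_zero, LinearMap.zero_apply]
  | hadd a b ha hb =>
    change dualHom _ _ (tensorMap U V X Y ((a : U ⟶ V) + (b : U ⟶ V)) g) =
      tensorMap V U Y X (dualHom U V ((a : U ⟶ V) + (b : U ⟶ V))) _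
    simp only [map_add, LinearMap.add_apply]
    exact congrArg₂ (· + ·) ha hb
  | hsmul c t => ?_
  induction g using HomSpace.induction with
  | h0 =>
    change dualHom _ _ (tensorMap U V X Y (c • t.hom) 0) = tensorMap V U Y X _ (dualHom X Y 0)
    simp only [map_zero]
  | hadd a b ha hb =>
    change dualHom _ _ (tensorMap U V X Y (c • t.hom) ((a : X ⟶ Y) + (b : X ⟶ Y))) =
      tensorMap V U Y X _ (dualHom X Y ((a : X ⟶ Y) + (b : X ⟶ Y)))
    simp only [map_add]
    exact congrArg₂ (· + ·) ha hb
  | hsmul c' s => ?_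
  change dualHom _ _ (tensorMap U V X Y (c • t.hom) (c' • s.hom)) =
    tensorMap V U Y X (dualHom U V (c • t.hom)) (dualHom X Y (c' • s.hom))
  simp only [map_smul, LinearMap.smul_apply, hb, hd]
  congr 2
  exact dualMap_tensor t s

end Tensor

end HallFlag

theorem mainTheorem8 (k : Type u) [Field k] [Finite k] :
    (∀ (V W : HallFlag.FlagSpace.{v} k) (t : HallFlag.Triple V W),
      ∃ s : HallFlag.Triple W V, t.IsDual s) ∧
    ∃! D : ∀ V W : HallFlag.FlagSpace.{v} k, (V ⟶ W) →ₗ[ℚ] (W ⟶ V),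
      (∀ (V W : HallFlag.FlagSpace.{v} k) (t : HallFlag.Triple V W) (s : HallFlag.Triple W V),
        t.IsDual s → D V W t.hom = s.hom) ∧
      (∃ (hid : ∀ V, D V V (𝟙 V) = 𝟙 V)
        (hcomp : ∀ (U V W : HallFlag.FlagSpace.{v} k) (f : U ⟶ V) (g : V ⟶ W),
          D U W (f ≫ g) = D V W g ≫ D U V f),
        (HallFlag.contravariantFunctor D hid hcomp).IsEquivalence) ∧
      (∀ (U V X Y : HallFlag.FlagSpace.{v} k) (f : U ⟶ V) (g : X ⟶ Y),
        D (HallFlag.tensorObj U X) (HallFlag.tensorObj V Y) (HallFlag.tensorMap U V X Y f g) =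
          HallFlag.tensorMap V U Y X (D U V f) (D X Y g)) := by
  refine ⟨fun V W t => ⟨t.dual, t.isDual_dual⟩, HallFlag.dualHom,
    ⟨fun V W t s h => HallFlag.dualMap_basis h,
      ⟨HallFlag.dualMap_homId, fun U V W => HallFlag.dualMap_homComp,
        HallFlag.isEquivalence_contravariantFunctor_dualHom _ _⟩,
      fun U V X Y => HallFlag.dualHom_tensorMap⟩, ?_⟩
  rintro D ⟨hD, -, -⟩
  refine funext fun V => funext fun W => Finsupp.lhom_ext' fun a => LinearMap.ext_ring ?_
  obtain ⟨t, rfl⟩ := Quotient.exists_rep a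
  exact (hD V W t _ t.isDual_dual).trans (HallFlag.dualMap_basis t.isDual_dual).symm
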